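/- An outdegree-vertex sequence (OVS) is a finite sequence $d^+=((d_1,v_1),\dots,(d_n,v_n))$ with distinct vertices $v_i$ and integers $d_i\ge 0$. An oriented graph is a digraph without loops, parallel edges or pairs of opposite edges. An oriented graph with vertex set $V=\{v_1,\dots,v_n\}$ realizes $d^+$ if $v_i$ has outdegree $d_i$ for every $i$ (indegrees are unconstrained); $d^+$ is an OVGS if some oriented graph realizes it. Greedy algorithm. Arrange $d^+$ so that the numbers $d_i$ are nondecreasing. Let $i_0-1$ be the number of leading vertices of prescribed outdegree $0$, let $W$ be the set of these vertices, and let $G$ be the digraph on $V$ without edges. For $i=i_0,\dots,n$: rearrange $d^+$ so that the vertices of $W$ come first and the remaining ones are ordered by (prescribed outdegree) + (indegree in $G$), ties being ordered by prescribed outdegree (any such arrangement may be taken); let $v$ be the vertex in position $i$ and $d$ its prescribed outdegree, and let $A$ be the set of vertices other than $v$ that are not in-neighbours of $v$ in $G$; if $|A|<d$, answer "No" and stop; otherwise add to $G$ the edges from $v$ to the $d$ vertices of $A$ in the smallest positions, and put $v$ into $W$. At the end return $G$. **Theorem.** For every OVS $d^+$, every run of the greedy algorithm (whichever arrangements are chosen)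 answers "No" if and only if $d^+$ is not an OVGS, and if $d^+$ is an OVGS, it returns a realization of $d^+$. The algorithm runs in polynomial time: there is one program for a random access machine (unit cost for reading and writing memory, for addition, truncated subtraction and multiplication, and for comparisons; all numbers written are bounded by a fixed power of $n+\max_i d_i+2$) that, for every OVS $d^+$ of length $n$, given $n$ and $(d_1,\dots,d_n)$, halts within $T(n)$ steps, where $T(n)=O(n^2\log n)$, and outputs the outcome of a run of the greedy algorithm on $d^+$: the answer "No", or the adjacency matrix of the returned realization. -/

import Mathlib

open Filter Asymptotics

/-! ### Outdegree-vertex sequences and their realizations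

An outdegree-vertex sequence `((d₁, v₁), …, (dₙ, vₙ))` has `n` distinct vertices; the vertex `vᵢ` is
represented by its index in the given sequence, so that the sequence is the function `d` on `Fin n`.
Rearrangements of the sequence are permutations `σ` of `Fin n`: the vertex in position `i` of the
rearranged sequence is `σ i`, with prescribed outdegree `d (σ i)`. Positions count from `0`. -/

/-- An outdegree-vertex sequence of length `n`. -/
abbrev OVS (n : ℕ) := Fin n → ℕ

/-- A digraph is an oriented graph if it has no loops and no pair of opposite edges
(the case `u = v` excludes loops). -/
def IsOriented {V : Type*} (G : Digraph V) : Prop :=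
  ∀ u v, G.Adj u v → ¬ G.Adj v u

/-- The set of out-neighbours of `v`. -/
def outNbrs {V : Type*} (G : Digraph V) (v : V) : Set V := {w | G.Adj v w}

/-- The set of in-neighbours of `v`. -/
def inNbrs {V : Type*} (G : Digraph V) (v : V) : Set V := {u | G.Adj u v}

/-- `G` is an oriented graph in which every vertex has the prescribed outdegree. -/
def Realizes {n : ℕ} (d : OVS n) (G : Digraph (Fin n)) : Prop :=
  IsOriented G ∧ ∀ v, (outNbrs G v).ncard = d v

/-- `d` is an outdegree-vertex graphical sequence. -/
def IsOVGS {n : ℕ} (d : OVS n) : Prop := ∃ G : Digraph (Fin n), Realizes d G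

/-! ### The greedy algorithm -/

/-- The sequence, arranged by `σ`, is normal. -/
def IsNormal {n : ℕ} (d : OVS n) (σ : Equiv.Perm (Fin n)) : Prop :=
  ∀ i j : Fin n, (i : ℕ) + 1 = j → d (σ i) ≤ d (σ j)

/-- The sequence, arranged by `σ`, is `G_W`-normal: the vertices of `W` come first, and the other
ones are ordered by prescribed outdegree plus current indegree, ties being ordered by prescribed
outdegree. -/
def IsGNormal {n : ℕ} (d : OVS n) (W : Set (Fin n)) (G : Digraph (Fin n))
    (σ : Equiv.Perm (Fin n)) : Prop :=
  (∀ i : Fin n, (i : ℕ) < W.ncard → σ i ∈ W) ∧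
  ∀ i j : Fin n, W.ncard ≤ (i : ℕ) → (i : ℕ) + 1 = j →
    d (σ i) + (inNbrs G (σ i)).ncard < d (σ j) + (inNbrs G (σ j)).ncard ∨
    (d (σ i) + (inNbrs G (σ i)).ncard = d (σ j) + (inNbrs G (σ j)).ncard ∧ d (σ i) ≤ d (σ j))

/-- The vertices that are allowed as out-neighbours of `v`. -/
def allowed {n : ℕ} (G : Digraph (Fin n)) (v : Fin n) : Set (Fin n) := {w | w ∉ inNbrs G v ∧ w ≠ v}

/-- `L` consists of the `k` elements of `A` with the smallest positions in the arrangement `σ`. -/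
def IsLeftmost {n : ℕ} (σ : Equiv.Perm (Fin n)) (A : Set (Fin n)) (k : ℕ) (L : Set (Fin n)) :
    Prop :=
  L ⊆ A ∧ L.ncard = k ∧ ∀ u ∈ L, ∀ w ∈ A, w ∉ L → σ.symm u < σ.symm w

/-- The digraph obtained from `G` by adding the edges from `v` to all vertices in `L`. -/
def connect {n : ℕ} (G : Digraph (Fin n)) (v : Fin n) (L : Set (Fin n)) : Digraph (Fin n) where
  Adj u w := G.Adj u w ∨ (u = v ∧ w ∈ L)

/-- The main loop of the algorithm, as a relation between the loop index `i`, the set `W` of the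
processed vertices, the current graph `G`, and the outcome (`none` is the answer "No").
In every round the sequence is made `G_W`-normal, with an arbitrary choice among the
arrangements that are `G_W`-normal; then the vertex in position `i` is either refused, which
stops the algorithm, or connected to the leftmost allowed vertices, and added to `W`. -/
inductive GreedyLoop {n : ℕ} (d : OVS n) :
    ℕ → Set (Fin n) → Digraph (Fin n) → Option (Digraph (Fin n)) → Prop
  | finish (i : ℕ) (W : Set (Fin n)) (G : Digraph (Fin n)) (hi : n ≤ i) :
      GreedyLoop d i W G (some G)
  | refuse (i : Fin n) (W : Set (Fin n)) (G : Digraph (Fin n)) (σ : Equiv.Perm (Fin n))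
      (hσ : IsGNormal d W G σ) (hA : (allowed G (σ i)).ncard < d (σ i)) :
      GreedyLoop d i W G none
  | extend (i : Fin n) (W : Set (Fin n)) (G : Digraph (Fin n)) (σ : Equiv.Perm (Fin n))
      (L : Set (Fin n)) (r : Option (Digraph (Fin n)))
      (hσ : IsGNormal d W G σ) (hA : d (σ i) ≤ (allowed G (σ i)).ncard)
      (hL : IsLeftmost σ (allowed G (σ i)) (d (σ i)) L)
      (hr : GreedyLoop d (i + 1) (insert (σ i) W) (connect G (σ i) L) r) :
      GreedyLoop d i W G r

/-- `GreedyRun d r`: some run of the greedy algorithm on `d` ends with the outcome `r`, which is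
`some G` if the graph `G` is returned, and `none` if the answer is "No". The sequence is made normal,
the first `i₀` positions, which are those of the vertices of outdegree zero, are
put into `W`, and the main loop starts at `i₀` with the graph without edges. -/
def GreedyRun {n : ℕ} (d : OVS n) (r : Option (Digraph (Fin n))) : Prop :=
  ∃ (σ : Equiv.Perm (Fin n)) (i₀ : ℕ), IsNormal d σ ∧ i₀ ≤ n ∧
    (∀ j : Fin n, (j : ℕ) < i₀ → d (σ j) = 0) ∧
    (∀ j : Fin n, (j : ℕ) = i₀ → d (σ j) ≠ 0) ∧
    GreedyLoop d i₀ {v | ∃ j : Fin n, (j : ℕ) < i₀ ∧ σ j = v} ⊥ r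

/-! ### Random access machines with bounded words

Structured programs for a random access machine. It has registers `0, 1, 2, …` and arrays
`0, 1, 2, …` of unlimited length, all of whose cells hold natural numbers. A program mentions finitely
many registers and arrays, and array cells are accessed by indirect addressing. Each elementary
instruction and each test costs one step; all numbers that are written must be at most the word
bound `B`. -/

/-- Arithmetical operations of the machine. -/
inductive RamOp
  | add
  | sub
  | mul

/-- The value of an operation; the subtraction is truncated at zero. -/
def RamOp.eval : RamOp → ℕ → ℕ → ℕ
  | .add, a, b => a + b
  | .sub, a, b => a - b
  | .mul, a, b => a * b

/-- Programs. The test in `ite x y p q` and `loop x y p` is whether register `x` holds a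
number smaller than register `y`. -/
inductive RamProg
  | skip
  | const (x k : ℕ)
  | copy (x y : ℕ)
  | arith (o : RamOp) (x y z : ℕ)
  | load (x a y : ℕ)
  | store (a x y : ℕ)
  | seq (p q : RamProg)
  | ite (x y : ℕ) (p q : RamProg)
  | loop (x y : ℕ) (p : RamProg)

/-- A state of the machine: the contents of the registers, and of the cells of the arrays. -/
structure RamState where
  reg : ℕ → ℕ
  arr : ℕ → ℕ → ℕ

/-- Write `k` into register `x`. -/
def RamState.setReg (s : RamState) (x k : ℕ) : RamState where
  reg := Function.update s.reg x k
  arr := s.arr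

/-- Write `k` into cell `j` of array `a`. -/
def RamState.setArr (s : RamState) (a j k : ℕ) : RamState where
  reg := s.reg
  arr := Function.update s.arr a (Function.update (s.arr a) j k)

/-- `RamExec B p s t s'`: the program `p`, started in the state `s`, halts after exactly `t` steps in
the state `s'`, and never writes a number greater than `B`. -/
inductive RamExec (B : ℕ) : RamProg → RamState → ℕ → RamState → Prop
  | skip (s : RamState) : RamExec B .skip s 1 s
  | const (s : RamState) (x k : ℕ) (h : k ≤ B) :
      RamExec B (.const x k) s 1 (s.setReg x k)
  | copy (s : RamState) (x y : ℕ) (h : s.reg y ≤ B) :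
      RamExec B (.copy x y) s 1 (s.setReg x (s.reg y))
  | arith (s : RamState) (o : RamOp) (x y z : ℕ) (h : o.eval (s.reg y) (s.reg z) ≤ B) :
      RamExec B (.arith o x y z) s 1 (s.setReg x (o.eval (s.reg y) (s.reg z)))
  | load (s : RamState) (x a y : ℕ) (h : s.arr a (s.reg y) ≤ B) :
      RamExec B (.load x a y) s 1 (s.setReg x (s.arr a (s.reg y)))
  | store (s : RamState) (a x y : ℕ) (h : s.reg y ≤ B) :
      RamExec B (.store a x y) s 1 (s.setArr a (s.reg x) (s.reg y))
  | seq (p q : RamProg) (s₁ s₂ s₃ : RamState) (t₁ t₂ : ℕ)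
      (hp : RamExec B p s₁ t₁ s₂) (hq : RamExec B q s₂ t₂ s₃) :
      RamExec B (.seq p q) s₁ (t₁ + t₂) s₃
  | iteTrue (x y : ℕ) (p q : RamProg) (s s' : RamState) (t : ℕ)
      (h : s.reg x < s.reg y) (hp : RamExec B p s t s') :
      RamExec B (.ite x y p q) s (t + 1) s'
  | iteFalse (x y : ℕ) (p q : RamProg) (s s' : RamState) (t : ℕ)
      (h : ¬ s.reg x < s.reg y) (hq : RamExec B q s t s') :
      RamExec B (.ite x y p q) s (t + 1) s'
  | loopEnd (x y : ℕ) (p : RamProg) (s : RamState) (h : ¬ s.reg x < s.reg y) :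
      RamExec B (.loop x y p) s 1 s
  | loopStep (x y : ℕ) (p : RamProg) (s₁ s₂ s₃ : RamState) (t₁ t₂ : ℕ)
      (h : s₁.reg x < s₁.reg y) (hp : RamExec B p s₁ t₁ s₂)
      (hl : RamExec B (.loop x y p) s₂ t₂ s₃) :
      RamExec B (.loop x y p) s₁ (t₁ + t₂ + 1) s₃

/-- The machine is deterministic: running time and final state are determined. -/
theorem RamExec.deterministic {B : ℕ} {p : RamProg} {s s₁ s₂ : RamState} {t₁ t₂ : ℕ}
    (h₁ : RamExec B p s t₁ s₁) (h₂ : RamExec B p s t₂ s₂) : t₁ = t₂ ∧ s₁ = s₂ := by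
  induction h₁ generalizing t₂ s₂ with
  | skip | const | copy | arith | load | store => cases h₂; exact ⟨rfl, rfl⟩
  | seq p q a b c u v hp hq ihp ihq =>
    cases h₂ with
    | seq _ _ _ b' _ u' v' hp' hq' =>
      obtain ⟨rfl, rfl⟩ := ihp hp'
      obtain ⟨rfl, rfl⟩ := ihq hq'
      exact ⟨rfl, rfl⟩
  | iteTrue x y p q a b u h hp ih =>
    cases h₂ with
    | iteTrue _ _ _ _ _ _ _ _ hp' => obtain ⟨rfl, rfl⟩ := ih hp'; exact ⟨rfl, rfl⟩
    | iteFalse _ _ _ _ _ _ _ h' _ => exact absurd h h'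
  | iteFalse x y p q a b u h hp ih =>
    cases h₂ with
    | iteTrue _ _ _ _ _ _ _ h' _ => exact absurd h' h
    | iteFalse _ _ _ _ _ _ _ _ hp' => obtain ⟨rfl, rfl⟩ := ih hp'; exact ⟨rfl, rfl⟩
  | loopEnd x y p a h =>
    cases h₂ with
    | loopEnd => exact ⟨rfl, rfl⟩
    | loopStep _ _ _ _ _ _ _ _ h' _ _ => exact absurd h' h
  | loopStep x y p a b c u v h hp hl ihp ihl =>
    cases h₂ with
    | loopEnd _ _ _ _ h' => exact absurd h h'
    | loopStep _ _ _ _ b' _ u' v' _ hp' hl' =>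
      obtain ⟨rfl, rfl⟩ := ihp hp'
      obtain ⟨rfl, rfl⟩ := ihl hl'
      exact ⟨rfl, rfl⟩

/-- The initial state for the input `d`: register `0` holds the length `n`, array `0` holds the
prescribed outdegrees in the given order, everything else is zero. -/
def ramInput {n : ℕ} (d : OVS n) : RamState where
  reg x := if x = 0 then n else 0
  arr a j := if h : a = 0 ∧ j < n then d ⟨j, h.2⟩ else 0

/-- The final state `s` shows the outcome `r`: the answer "No" is `0` in register `0`; a returned
graph is announced by `1` in register `0` and given by its adjacency matrix, row by
row, in array `1`. -/
def RamOutput {n : ℕ} (s : RamState) : Option (Digraph (Fin n)) → Prop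
  | none => s.reg 0 = 0
  | some G => s.reg 0 = 1 ∧ ∀ u v : Fin n,
      (G.Adj u v → s.arr 1 (u * n + v) = 1) ∧ (¬ G.Adj u v → s.arr 1 (u * n + v) = 0)

/-! ### Changing a few edges of a realization -/

/-! Correctness is an exchange argument. Let `H` be a realization that agrees with the current graph
`G` on the edges leaving `W`, and let `v` be the selected vertex. If `H` joins `v` to `y` but not to
a preferred vertex `x`, then `H` can be changed, without touching the edges leaving `W`, so that `y`
is replaced by `x` among the out-neighbours of `v` (`exists_exchange`). When `x` and `v` are
nonadjacent, one edge is moved. When `x → v` is an edge, comparing prescribed outdegree plus current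
indegree of `x` and `y` yields a directed cycle of length 3 or 4 through `x → v → y` that can be
reversed, or a vertex to which the edge `x → v` can first be diverted. Repeating this makes the
out-neighbourhood of `v` equal to the greedy choice (`exists_realizes_outNbrs_eq`). So extendability
to a realization is invariant for every arrangement the algorithm may choose (`LoopInv.connect`),
and a refusal contradicts extendability (`LoopInv.not_isOVGS`).

For the running time, the order is repaired rather than recomputed. One quadratic insertion sort
prepares the first arrangement. When the vertex in position `i` is connected, all later vertices in
front of a certain position `S` gain one in-neighbour and those from `S` on gain none. The rest
therefore splits into two sorted runs, which a linear merge combines. Each round costs `O(n)` and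
the whole program `O(n²)`, which is within the required bound.

The program is tied to the abstract algorithm by `MainInv`: its field `cont` says that every outcome
of the loop from the current state is an outcome of a complete run, so a relation defined backwards
from its end can be followed forwards. -/

theorem ncard_insert_sdiff {V : Type*} [Finite V] {S : Set V} {x y : V} (hx : x ∉ S) (hy : y ∈ S) :
    (insert x (S \ {y})).ncard = S.ncard := by
  rw [Set.ncard_insert_of_notMem (fun h => hx h.1), Set.ncard_sdiff_singleton_add_one hy]

/-- The digraph in which the edge from `v` to `y` is replaced by an edge from `v` to `x`. -/
def shiftEdge {V : Type*} (H : Digraph V) (v y x : V) : Digraph V where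
  Adj a b := (H.Adj a b ∧ ¬ (a = v ∧ b = y)) ∨ (a = v ∧ b = x)

theorem outNbrs_shiftEdge_self {V : Type*} (H : Digraph V) (v y x : V) :
    outNbrs (shiftEdge H v y x) v = insert x (outNbrs H v \ {y}) := by
  ext b
  simp only [outNbrs, shiftEdge, Set.mem_ofPred_eq, Set.mem_insert_iff, Set.mem_sdiff,
    Set.mem_singleton_iff]
  tauto

theorem outNbrs_shiftEdge_of_ne {V : Type*} (H : Digraph V) {v u : V} (y x : V) (h : u ≠ v) :
    outNbrs (shiftEdge H v y x) u = outNbrs H u := by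
  ext b
  simp [outNbrs, shiftEdge, h]

/-- The new edge joins a nonadjacent pair, so no opposite edges arise, and only `v` changes its
out-neighbourhood, by a one-for-one replacement. -/
theorem Realizes.shiftEdge {n : ℕ} {d : OVS n} {H : Digraph (Fin n)} (hH : Realizes d H)
    {v y x : Fin n} (hvy : H.Adj v y) (hvx : ¬ H.Adj v x) (hxv : ¬ H.Adj x v) (hne : x ≠ v) :
    Realizes d (shiftEdge H v y x) := by
  refine ⟨?_, fun u => ?_⟩
  · rintro a b (⟨hab, -⟩ | ⟨rfl, rfl⟩) (⟨hba, -⟩ | ⟨h1, h2⟩)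
    · exact hH.1 _ _ hab hba
    · subst h1 h2; exact hxv hab
    · exact hxv hba
    · exact hne h1
  · by_cases hu : u = v
    · subst hu
      rw [outNbrs_shiftEdge_self, ncard_insert_sdiff (S := outNbrs H u) hvx hvy, hH.2]
    · rw [outNbrs_shiftEdge_of_ne _ _ _ hu, hH.2]

/-- The digraph in which the cycles of the permutation `π` are reversed. -/
def reverseCycles {V : Type*} (H : Digraph V) (π : Equiv.Perm V) : Digraph V where
  Adj a b := (H.Adj a b ∧ b ≠ π a) ∨ (a = π b ∧ π b ≠ b)

theorem outNbrs_reverseCycles_of_ne {V : Type*} (H : Digraph V) (π : Equiv.Perm V) {u : V}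
    (hu : π u ≠ u) :
    outNbrs (reverseCycles H π) u = insert (π.symm u) (outNbrs H u \ {π u}) := by
  ext b
  simp only [outNbrs, reverseCycles, Set.mem_ofPred_eq, Set.mem_insert_iff, Set.mem_sdiff,
    Set.mem_singleton_iff, Equiv.eq_symm_apply]
  constructor
  · rintro (h | h)
    · exact Or.inr h
    · exact Or.inl h.1.symm
  · rintro (h | h)
    · refine Or.inr ⟨h.symm, fun h' => hu ?_⟩
      have : b = u := h'.symm.trans h
      rw [← this]; exact h'
    · exact Or.inl h

theorem outNbrs_reverseCycles_of_eq {V : Type*} (H : Digraph V) (π : Equiv.Perm V) {u : V}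
    (hu : π u = u) (hirr : ¬ H.Adj u u) : outNbrs (reverseCycles H π) u = outNbrs H u := by
  ext b
  simp only [outNbrs, reverseCycles, Set.mem_ofPred_eq, hu]
  constructor
  · rintro (h | ⟨h, h'⟩)
    · exact h.1
    · exact absurd (π.injective (hu.trans h)) fun e => h' (by rw [← e]; exact hu)
  · intro h
    exact Or.inl ⟨h, fun e => hirr (e ▸ h)⟩

/-- A vertex on a cycle trades its successor for its predecessor as an out-neighbour. The
predecessor was not one before, because `H` has no opposite edges; for the same reason `π` has no
2-cycles. -/
theorem Realizes.reverseCycles {n : ℕ} {d : OVS n} {H : Digraph (Fin n)} (hH : Realizes d H)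
    {π : Equiv.Perm (Fin n)} (hπ : ∀ a, π a ≠ a → H.Adj a (π a)) :
    Realizes d (reverseCycles H π) := by
  have hirr : ∀ u, ¬ H.Adj u u := fun u h => hH.1 u u h h
  refine ⟨?_, fun u => ?_⟩
  · rintro a b (⟨hab, h1⟩ | ⟨h1, h2⟩) (⟨hba, h3⟩ | ⟨h3, h4⟩)
    · exact hH.1 _ _ hab hba
    · exact h1 h3
    · exact h3 h1
    · have := hπ b h2
      have h' := hπ a h4
      rw [← h1] at this
      rw [← h3] at h'
      exact hH.1 _ _ this h'
  · by_cases hu : π u = u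
    · rw [outNbrs_reverseCycles_of_eq H π hu (hirr u), hH.2]
    · rw [outNbrs_reverseCycles_of_ne H π hu, ncard_insert_sdiff, hH.2]
      · intro h
        have := hπ (π.symm u) (fun e => hu (by
          rw [Equiv.apply_symm_apply] at e; nth_rewrite 1 [e]; simp))
        rw [Equiv.apply_symm_apply] at this
        exact hH.1 _ _ h this
      · exact hπ u hu

/-! ### Correctness of the greedy algorithm -/

/-- Some realization of `d` has the same edges as `G` at the vertices of `W`. -/
def Extendable {n : ℕ} (d : OVS n) (W : Set (Fin n)) (G : Digraph (Fin n)) : Prop :=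
  ∃ H, Realizes d H ∧ ∀ u ∈ W, outNbrs H u = outNbrs G u

/-- The single exchange on which correctness rests. Every modification uses only edges leaving
vertices outside `W`, so agreement with `G` on `W` survives. -/
theorem exists_exchange {n : ℕ} {d : OVS n} {W : Set (Fin n)} {G H : Digraph (Fin n)}
    (hG : ∀ u w, G.Adj u w → u ∈ W) (hH : Realizes d H)
    (hW : ∀ u ∈ W, outNbrs H u = outNbrs G u) {v x y : Fin n} (hv : v ∉ W)
    (hx : x ∈ allowed G v) (hvx : ¬ H.Adj v x) (hvy : H.Adj v y)
    (hxy : x ∉ W → y ∉ W ∧ d x + (inNbrs G x).ncard ≤ d y + (inNbrs G y).ncard) :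
    ∃ H', Realizes d H' ∧ (∀ u ∈ W, outNbrs H' u = outNbrs G u) ∧
      outNbrs H' v = insert x (outNbrs H v \ {y}) := by
  have hGH : ∀ u w, G.Adj u w → H.Adj u w := fun u w h => by
    have := hW u (hG u w h)
    exact (Set.ext_iff.1 this w).2 h
  have hHG : ∀ u w, u ∈ W → H.Adj u w → G.Adj u w := fun u w hu h =>
    (Set.ext_iff.1 (hW u hu) w).1 h
  have hirr : ∀ u, ¬ H.Adj u u := fun u h => hH.1 u u h h
  have hne : x ≠ v := hx.2
  -- If `x` and `v` are nonadjacent in `H`, moving one edge suffices. Otherwise `x → v` is an edge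
  -- of `H`; as `x` is allowed it is not an edge of `G`, so `x ∉ W` and the comparison with `y` is
  -- available.
  by_cases hxv : H.Adj x v
  swap
  · refine ⟨shiftEdge H v y x, hH.shiftEdge hvy hvx hxv hne, fun u hu => ?_,
      outNbrs_shiftEdge_self _ _ _ _⟩
    rw [outNbrs_shiftEdge_of_ne _ _ _ (ne_of_mem_of_not_mem hu hv), hW u hu]
  have hxW : x ∉ W := fun h => hx.1 (hHG x v h hxv)
  obtain ⟨hyW, hle⟩ := hxy hxW
  have hvy' : v ≠ y := fun e => hirr v (by nth_rewrite 2 [e]; exact hvy)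
  have hxy' : x ≠ y := fun e => hvx (e ▸ hvy)
  have reverse : ∀ π : Equiv.Perm (Fin n), (∀ a, π a ≠ a → H.Adj a (π a)) → (∀ u ∈ W, π u = u) →
      π v = y → π x = v → ∃ H', Realizes d H' ∧ (∀ u ∈ W, outNbrs H' u = outNbrs G u) ∧
      outNbrs H' v = insert x (outNbrs H v \ {y}) := by
    intro π h1 h2 h3 h4
    refine ⟨reverseCycles H π, hH.reverseCycles h1, fun u hu => ?_, ?_⟩
    · rw [outNbrs_reverseCycles_of_eq H π (h2 u hu) (hirr u), hW u hu]
    · rw [outNbrs_reverseCycles_of_ne H π (by rw [h3]; exact hvy'.symm), h3,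
        (Equiv.symm_apply_eq π).2 h4.symm]
  -- Here the triangle `v → y → x → v` is reversed.
  by_cases hyx : H.Adj y x
  · refine reverse (Equiv.swap x v * Equiv.swap v y) ?_ ?_ ?_ ?_
    · intro a
      simp only [Equiv.Perm.mul_apply, Equiv.swap_apply_def]
      split_ifs <;> simp_all
    · intro u hu
      have h1 : u ≠ x := fun e => hxW (e ▸ hu)
      have h2 : u ≠ v := fun e => hv (e ▸ hu)
      have h3 : u ≠ y := fun e => hyW (e ▸ hu)
      simp [Equiv.swap_apply_of_ne_of_ne, h1, h2, h3]
    · simp [Equiv.swap_apply_of_ne_of_ne, hxy'.symm, hvy'.symm]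
    · simp [Equiv.swap_apply_of_ne_of_ne, hxy', hne]
  have hcard : ∀ u, (outNbrs H u ∪ inNbrs G u).ncard = d u + (inNbrs G u).ncard := fun u => by
    rw [Set.ncard_union_eq ?_ (Set.toFinite _) (Set.toFinite _), hH.2]
    exact Set.disjoint_left.2 fun w h1 h2 => hH.1 _ _ h1 (hGH _ _ h2)
  -- The sets for `x` and `y` have sizes `d + indegree in G`, hence the set of `y` is at least as
  -- large. As `v` belongs to that of `x` but not to that of `y`, the latter cannot be contained in
  -- the former.
  obtain ⟨z, hzy, hzx⟩ : ∃ z ∈ outNbrs H y ∪ inNbrs G y, z ∉ outNbrs H x ∪ inNbrs G x := by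
    by_contra hcon
    push Not at hcon
    have hlt : (outNbrs H y ∪ inNbrs G y).ncard < (outNbrs H x ∪ inNbrs G x).ncard := by
      refine Set.ncard_lt_ncard ⟨hcon, fun h => ?_⟩ (Set.toFinite _)
      rcases h (Or.inl hxv : v ∈ _) with h | h
      · exact hH.1 _ _ hvy h
      · exact hv (hG _ _ h)
    rw [hcard, hcard] at hlt
    omega
  have hzx1 : ¬ H.Adj x z := fun h => hzx (Or.inl h)
  have hzx2 : ¬ G.Adj z x := fun h => hzx (Or.inr h)
  have hzney : z ≠ y := by
    rintro rfl
    exact hzy.elim (hirr z) fun h => hyW (hG _ _ h)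
  have hznev : z ≠ v := by
    rintro rfl
    exact hzx1 hxv
  have hznex : z ≠ x := by
    rintro rfl
    exact hzy.elim hyx fun h => hxW (hG _ _ h)
  -- If `z → x` is an edge, then `z ∉ W`, so `y → z` is an edge too and the 4-cycle `v → y → z → x →
  -- v` is reversed. Otherwise `x` and `z` are nonadjacent: diverting `x → v` to `x → z` frees the
  -- pair `x`, `v` for the simple move.
  by_cases hzx3 : H.Adj z x
  · have hzW : z ∉ W := fun h => hzx2 (hHG _ _ h hzx3)
    have hyz : H.Adj y z := hzy.elim id fun h => absurd (hG _ _ h) hzW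
    refine reverse (Equiv.swap x v * Equiv.swap v y * Equiv.swap y z) ?_ ?_ ?_ ?_
    · intro a
      simp only [Equiv.Perm.mul_apply, Equiv.swap_apply_def]
      split_ifs <;> simp_all
    · intro u hu
      have h1 : u ≠ x := fun e => hxW (e ▸ hu)
      have h2 : u ≠ v := fun e => hv (e ▸ hu)
      have h3 : u ≠ y := fun e => hyW (e ▸ hu)
      have h4 : u ≠ z := fun e => hzW (e ▸ hu)
      simp [Equiv.swap_apply_of_ne_of_ne, h1, h2, h3, h4]
    · simp [Equiv.swap_apply_of_ne_of_ne, hxy'.symm, hvy'.symm, hvy', hznev.symm]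
    · simp [Equiv.swap_apply_of_ne_of_ne, hxy', hne, hznex.symm]
  · have h1 := hH.shiftEdge hxv hzx1 hzx3 hznex
    have hvx2 : ¬ (shiftEdge H x v z).Adj v x := by
      simp [shiftEdge, hvx, hne.symm]
    have hxv2 : ¬ (shiftEdge H x v z).Adj x v := by
      simp [shiftEdge, hznev.symm]
    have hvy2 : (shiftEdge H x v z).Adj v y := by
      simp [shiftEdge, hvy, hne.symm]
    refine ⟨_, h1.shiftEdge hvy2 hvx2 hxv2 hne, fun u hu => ?_, ?_⟩
    · rw [outNbrs_shiftEdge_of_ne _ _ _ (ne_of_mem_of_not_mem hu hv),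
        outNbrs_shiftEdge_of_ne _ _ _ (ne_of_mem_of_not_mem hu hxW), hW u hu]
    · rw [outNbrs_shiftEdge_self, outNbrs_shiftEdge_of_ne _ _ _ hne.symm]

/-- Any set `L` of allowed vertices that is preferred to the other ones can be the set of
out-neighbours of `v`. -/
theorem exists_realizes_outNbrs_eq {n : ℕ} {d : OVS n} {W : Set (Fin n)} {G : Digraph (Fin n)}
    (hG : ∀ u w, G.Adj u w → u ∈ W) {v : Fin n} (hv : v ∉ W) {L : Set (Fin n)}
    (hL : L ⊆ allowed G v) (hcard : L.ncard = d v)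
    (hpref : ∀ x ∈ L, ∀ y ∈ allowed G v, y ∉ L → x ∉ W →
      y ∉ W ∧ d x + (inNbrs G x).ncard ≤ d y + (inNbrs G y).ncard) :
    Extendable d W G →
    ∃ H, Realizes d H ∧ (∀ u ∈ W, outNbrs H u = outNbrs G u) ∧ outNbrs H v = L := by
  -- Induction on the number of vertices of `L` not yet reached from `v`; each exchange removes
  -- exactly one of them.
  suffices h : ∀ (k : ℕ) (H : Digraph (Fin n)), (L \ outNbrs H v).ncard = k → Realizes d H →
      (∀ u ∈ W, outNbrs H u = outNbrs G u) →
      ∃ H, Realizes d H ∧ (∀ u ∈ W, outNbrs H u = outNbrs G u) ∧ outNbrs H v = L by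
    rintro ⟨H, h1, h2⟩
    exact h _ H rfl h1 h2
  intro k
  induction k with
  | zero =>
    intro H hk hH hW
    rw [Set.ncard_eq_zero (Set.toFinite _), Set.sdiff_eq_empty] at hk
    exact ⟨H, hH, hW, (Set.eq_of_subset_of_ncard_le hk (by rw [hH.2, hcard])
      (Set.toFinite _)).symm⟩
  | succ k ih =>
    intro H hk hH hW
    obtain ⟨x, hxL, hx⟩ : (L \ outNbrs H v).Nonempty := by
      rw [← Set.ncard_pos (Set.toFinite _)]; omega
    obtain ⟨y, hy, hyL⟩ : ∃ y ∈ outNbrs H v, y ∉ L := by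
      by_contra hcon
      push Not at hcon
      have := Set.eq_of_subset_of_ncard_le (s := outNbrs H v) (t := L) hcon
        (by rw [hH.2, hcard]) (Set.toFinite _)
      exact hx (this ▸ hxL)
    have hyA : y ∈ allowed G v := by
      constructor
      · intro h
        have hyW := hG _ _ h
        exact hH.1 _ _ hy ((Set.ext_iff.1 (hW y hyW) v).2 h)
      · rintro rfl
        exact hH.1 _ _ hy hy
    obtain ⟨H', h1, h2, h3⟩ := exists_exchange hG hH hW hv (hL hxL) hx hy
      (hpref x hxL y hyA hyL)
    refine ih H' ?_ h1 h2
    have : L \ outNbrs H' v = (L \ outNbrs H v) \ {x} := by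
      rw [h3]
      ext w
      simp only [Set.mem_sdiff, Set.mem_insert_iff, Set.mem_singleton_iff]
      constructor
      · rintro ⟨a, b⟩
        push Not at b
        exact ⟨⟨a, fun h => hyL (b.2 h ▸ a)⟩, b.1⟩
      · rintro ⟨⟨a, b⟩, c⟩
        exact ⟨a, by tauto⟩
    rw [this]
    have := Set.ncard_sdiff_singleton_add_one (s := L \ outNbrs H v) ⟨hxL, hx⟩
    omega

theorem ncard_setOf_val_lt {n i : ℕ} (hi : i ≤ n) : {j : Fin n | (j : ℕ) < i}.ncard = i := by
  rw [← Set.ncard_image_of_injective _ Fin.val_injective]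
  have : Fin.val '' {j : Fin n | (j : ℕ) < i} = Set.Iio i := by
    ext m
    simp only [Set.mem_image, Set.mem_ofPred_eq, Set.mem_Iio]
    constructor
    · rintro ⟨i, hi, rfl⟩; exact hi
    · intro hm; exact ⟨⟨m, by omega⟩, hm, rfl⟩
  rw [this, Set.ncard_eq_toFinset_card']
  simp

/-- The vertices that a `G_W`-normal arrangement puts into the first positions are those of `W`. -/
theorem IsGNormal.mem_iff {n : ℕ} {d : OVS n} {W : Set (Fin n)} {G : Digraph (Fin n)}
    {σ : Equiv.Perm (Fin n)} (hσ : IsGNormal d W G σ) (j : Fin n) :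
    σ j ∈ W ↔ (j : ℕ) < W.ncard := by
  refine ⟨fun h => ?_, hσ.1 j⟩
  have hle : W.ncard ≤ n := by
    simpa using Set.ncard_le_card W
  have hsub : σ '' {i : Fin n | (i : ℕ) < W.ncard} ⊆ W := by
    rintro _ ⟨i, hi, rfl⟩
    exact hσ.1 i hi
  have hc := ncard_setOf_val_lt hle
  have heq := Set.eq_of_subset_of_ncard_le hsub
    (by rw [Set.ncard_image_of_injective _ σ.injective, hc]) (Set.toFinite _)
  rw [← heq] at h
  obtain ⟨i, hi, hij⟩ := h
  exact σ.injective hij ▸ hi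

/-- The exchange needs only the weak inequality between the sums; the rule for ties plays no role in
correctness. -/
theorem IsGNormal.le_of_lt {n : ℕ} {d : OVS n} {W : Set (Fin n)} {G : Digraph (Fin n)}
    {σ : Equiv.Perm (Fin n)} (hσ : IsGNormal d W G σ) {i j : Fin n} (hi : W.ncard ≤ i)
    (hij : i < j) :
    d (σ i) + (inNbrs G (σ i)).ncard ≤ d (σ j) + (inNbrs G (σ j)).ncard := by
  obtain ⟨j, hj⟩ := j
  induction j with
  | zero => exact absurd hij (by simp [Fin.lt_def])
  | succ k ih =>
    have hik : (i : ℕ) ≤ k := Nat.lt_succ_iff.1 hij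
    have hstep := hσ.2 ⟨k, by omega⟩ ⟨k + 1, hj⟩ (by simp; omega) rfl
    rcases hik.lt_or_eq with h | h
    · have := ih (by omega) h
      omega
    · have : i = ⟨k, by omega⟩ := Fin.ext h
      rw [this]
      omega

/-- The invariant of the main loop. -/
structure LoopInv {n : ℕ} (d : OVS n) (i : ℕ) (W : Set (Fin n)) (G : Digraph (Fin n)) : Prop where
  card : W.ncard = i
  mem_of_adj : ∀ u w, G.Adj u w → u ∈ W
  oriented : IsOriented G
  outdegree : ∀ u ∈ W, (outNbrs G u).ncard = d u
  extendable : IsOVGS d → Extendable d W G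

theorem outNbrs_connect_self {n : ℕ} (G : Digraph (Fin n)) (v : Fin n) (L : Set (Fin n)) :
    outNbrs (connect G v L) v = outNbrs G v ∪ L := by
  ext b
  simp [outNbrs, connect]

theorem outNbrs_connect_of_ne {n : ℕ} (G : Digraph (Fin n)) {v u : Fin n} (L : Set (Fin n))
    (h : u ≠ v) : outNbrs (connect G v L) u = outNbrs G u := by
  ext b
  simp [outNbrs, connect, h]

theorem LoopInv.notMem {n : ℕ} {d : OVS n} {i : Fin n} {W : Set (Fin n)} {G : Digraph (Fin n)}
    (h : LoopInv d i W G) {σ : Equiv.Perm (Fin n)} (hσ : IsGNormal d W G σ) : σ i ∉ W := by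
  rw [hσ.mem_iff, h.card]
  exact lt_irrefl _

/-- An extension of `G` contains the edges into `v` already present, so the out-neighbours it gives
to `v` are all allowed; there are too few of these. -/
theorem LoopInv.not_isOVGS {n : ℕ} {d : OVS n} {i : ℕ} {W : Set (Fin n)} {G : Digraph (Fin n)}
    (h : LoopInv d i W G) {v : Fin n} (hA : (allowed G v).ncard < d v) : ¬ IsOVGS d := by
  intro hd
  obtain ⟨H, hH, hHW⟩ := h.extendable hd
  have : outNbrs H v ⊆ allowed G v := by
    intro w hw
    constructor
    · intro hwv
      have hwW := h.mem_of_adj _ _ hwv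
      exact hH.1 _ _ hw ((Set.ext_iff.1 (hHW w hwW) v).2 hwv)
    · rintro rfl
      exact hH.1 _ _ hw hw
  have := Set.ncard_le_ncard this (Set.toFinite _)
  rw [hH.2] at this
  omega

theorem LoopInv.connect {n : ℕ} {d : OVS n} {i : Fin n} {W : Set (Fin n)} {G : Digraph (Fin n)}
    (h : LoopInv d i W G) {σ : Equiv.Perm (Fin n)} (hσ : IsGNormal d W G σ) {L : Set (Fin n)}
    (hL : IsLeftmost σ (allowed G (σ i)) (d (σ i)) L) :
    LoopInv d (i + 1) (insert (σ i) W) (connect G (σ i) L) := by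
  have hv := h.notMem hσ
  have hempty : outNbrs G (σ i) = ∅ := by
    ext w
    simp only [outNbrs, Set.mem_ofPred_eq, Set.mem_empty_iff_false, iff_false]
    exact fun hw => hv (h.mem_of_adj _ _ hw)
  have hself : outNbrs (_root_.connect G (σ i) L) (σ i) = L := by
    rw [outNbrs_connect_self, hempty, Set.empty_union]
  have hother : ∀ u ∈ W, outNbrs (_root_.connect G (σ i) L) u = outNbrs G u := fun u hu =>
    outNbrs_connect_of_ne G L fun e => hv (e ▸ hu)
  refine ⟨?_, ?_, ?_, ?_, ?_⟩
  · rw [Set.ncard_insert_of_notMem hv (Set.toFinite _), h.card]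
  · rintro u w (huw | ⟨rfl, -⟩)
    · exact Or.inr (h.mem_of_adj _ _ huw)
    · exact Or.inl rfl
  · rintro a b (hab | ⟨rfl, hb⟩) (hba | ⟨rfl, ha⟩)
    · exact h.oriented _ _ hab hba
    · exact (hL.1 ha).1 hab
    · exact (hL.1 hb).1 hba
    · exact (hL.1 hb).2 rfl
  · rintro u (rfl | hu)
    · rw [hself, hL.2.1]
    · rw [hother u hu, h.outdegree u hu]
  · intro hd
    -- The leftmost choice is preferred: if `x ∉ W`, its position is past those of `W`, so a
    -- rejected `y` further right is outside `W` and has at least the same sum.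
    obtain ⟨H, h1, h2, h3⟩ := exists_realizes_outNbrs_eq h.mem_of_adj hv hL.1 hL.2.1
      (fun x hx y hy hyL hxW => by
        have hlt := hL.2.2 x hx y hy hyL
        have hxp : W.ncard ≤ (σ.symm x : ℕ) := by
          have := hσ.mem_iff (σ.symm x)
          rw [Equiv.apply_symm_apply] at this
          exact not_lt.1 fun h' => hxW (this.2 h')
        have hyp := hσ.mem_iff (σ.symm y)
        have hle := hσ.le_of_lt hxp hlt
        simp only [Equiv.apply_symm_apply] at hyp hle
        refine ⟨fun h' => ?_, hle⟩
        have := hyp.1 h'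
        rw [Fin.lt_def] at hlt
        omega) (h.extendable hd)
    refine ⟨H, h1, ?_⟩
    rintro u (rfl | hu)
    · rw [h3, hself]
    · rw [h2 u hu, hother u hu]

theorem GreedyLoop.correct {n : ℕ} {d : OVS n} {i : ℕ} {W : Set (Fin n)} {G : Digraph (Fin n)}
    {r : Option (Digraph (Fin n))} (hr : GreedyLoop d i W G r) (h : LoopInv d i W G) :
    (r = none → ¬ IsOVGS d) ∧ ∀ G', r = some G' → Realizes d G' := by
  induction hr with
  | finish i W G hi =>
    refine ⟨by simp, ?_⟩
    rintro _ ⟨⟩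
    have hW : W = Set.univ := by
      refine Set.eq_of_subset_of_ncard_le (Set.subset_univ _) ?_ (Set.toFinite _)
      rw [h.card, Set.ncard_univ, Nat.card_fin]
      exact hi
    exact ⟨h.oriented, fun v => h.outdegree v (hW ▸ Set.mem_univ v)⟩
  | refuse i W G σ hσ hA =>
    exact ⟨fun _ => h.not_isOVGS hA, by simp⟩
  | extend i W G σ L r hσ hA hL hr ih => exact ih (h.connect hσ hL)

theorem ncard_setOf_exists_lt {n : ℕ} (σ : Equiv.Perm (Fin n)) {i : ℕ} (hi : i ≤ n) :
    {v | ∃ j : Fin n, (j : ℕ) < i ∧ σ j = v}.ncard = i := by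
  have h1 : {v | ∃ j : Fin n, (j : ℕ) < i ∧ σ j = v} = σ '' {j : Fin n | (j : ℕ) < i} := by
    rfl
  rw [h1, Set.ncard_image_of_injective _ σ.injective, ncard_setOf_val_lt hi]

theorem GreedyRun.correct {n : ℕ} {d : OVS n} {r : Option (Digraph (Fin n))}
    (hr : GreedyRun d r) : (r = none ↔ ¬ IsOVGS d) ∧ ∀ G, r = some G → Realizes d G := by
  obtain ⟨σ, i₀, -, hi, hzero, -, hloop⟩ := hr
  have hd : ∀ u ∈ {v | ∃ j : Fin n, (j : ℕ) < i₀ ∧ σ j = v}, d u = 0 := by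
    rintro u ⟨j, hj, rfl⟩
    exact hzero j hj
  have hbot : ∀ u : Fin n, outNbrs ⊥ u = ∅ := fun u => by
    ext w
    simp [outNbrs]
  have := hloop.correct
    { card := ncard_setOf_exists_lt σ hi
      mem_of_adj := fun u w h => absurd h (by simp)
      oriented := fun u w h => absurd h (by simp)
      outdegree := fun u hu => by rw [hbot, Set.ncard_empty, hd u hu]
      extendable := fun ⟨H, hH⟩ => ⟨H, hH, fun u hu => by
        rw [hbot, ← Set.ncard_eq_zero (Set.toFinite _), hH.2, hd u hu]⟩ }
  refine ⟨⟨this.1, fun hn => ?_⟩, this.2⟩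
  cases r with
  | none => rfl
  | some G => exact absurd ⟨G, this.2 G rfl⟩ hn

/-! ### Reasoning about programs -/

/-- The program `p`, started in `s`, halts within `T` steps in a state with the property `Q`. -/
def Runs (B : ℕ) (p : RamProg) (s : RamState) (T : ℕ) (Q : RamState → Prop) : Prop :=
  ∃ t s', RamExec B p s t s' ∧ t ≤ T ∧ Q s'

theorem Runs.mono {B : ℕ} {p : RamProg} {s : RamState} {T T' : ℕ} {Q Q' : RamState → Prop}
    (h : Runs B p s T Q) (hT : T ≤ T') (hQ : ∀ s', Q s' → Q' s') : Runs B p s T' Q' := by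
  obtain ⟨t, s', h1, h2, h3⟩ := h
  exact ⟨t, s', h1, h2.trans hT, hQ _ h3⟩

theorem Runs.seq {B : ℕ} {p q : RamProg} {s : RamState} {T₁ T₂ : ℕ} {R Q : RamState → Prop}
    (hp : Runs B p s T₁ R) (hq : ∀ s', R s' → Runs B q s' T₂ Q) :
    Runs B (.seq p q) s (T₁ + T₂) Q := by
  obtain ⟨t, s', h1, h2, h3⟩ := hp
  obtain ⟨t', s'', h1', h2', h3'⟩ := hq s' h3
  exact ⟨_, _, .seq _ _ _ _ _ _ _ h1 h1', by omega, h3'⟩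

theorem Runs.ite {B x y : ℕ} {p q : RamProg} {s : RamState} {T : ℕ} {Q : RamState → Prop}
    (hp : s.reg x < s.reg y → Runs B p s T Q) (hq : ¬ s.reg x < s.reg y → Runs B q s T Q) :
    Runs B (.ite x y p q) s (T + 1) Q := by
  by_cases h : s.reg x < s.reg y
  · obtain ⟨t, s', h1, h2, h3⟩ := hp h
    exact ⟨_, _, .iteTrue _ _ _ _ _ _ _ h h1, by omega, h3⟩
  · obtain ⟨t, s', h1, h2, h3⟩ := hq h
    exact ⟨_, _, .iteFalse _ _ _ _ _ _ _ h h1, by omega, h3⟩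

/-- A loop that increases the register `x` in every round until it reaches `N`. -/
theorem Runs.loop {B x y : ℕ} {p : RamProg} {C : ℕ} (N : ℕ) (I : RamState → Prop)
    (hN : ∀ s, I s → s.reg y = N)
    (hbody : ∀ s, I s → s.reg x < N → Runs B p s C fun s' => I s' ∧ s.reg x < s'.reg x)
    {s : RamState} (hs : I s) :
    Runs B (.loop x y p) s ((C + 1) * N + 1) fun s' => I s' ∧ N ≤ s'.reg x := by
  -- Induction on a bound for the remaining distance, since a round may advance `x` by more than
  -- one.
  suffices h : ∀ k s, I s → N - s.reg x ≤ k →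
      Runs B (.loop x y p) s ((C + 1) * k + 1) fun s' => I s' ∧ N ≤ s'.reg x from
    h N s hs (Nat.sub_le _ _)
  intro k
  induction k with
  | zero =>
    intro s hs hk
    have hle : N ≤ s.reg x := by omega
    exact ⟨1, s, .loopEnd _ _ _ _ (by rw [hN s hs]; omega), by omega, hs, hle⟩
  | succ k ih =>
    intro s hs hk
    by_cases hlt : s.reg x < N
    · obtain ⟨t, s', h1, h2, h3, h4⟩ := hbody s hs hlt
      obtain ⟨t', s'', h1', h2', h3'⟩ := ih s' h3 (by omega)
      refine ⟨_, _, .loopStep _ _ _ _ _ _ _ _ (by rw [hN s hs]; exact hlt) h1 h1', ?_, h3'⟩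
      rw [Nat.mul_succ]
      omega
    · exact ⟨1, s, .loopEnd _ _ _ _ (by rw [hN s hs]; omega), by omega, hs, by omega⟩

/-- The largest number of steps of a program without loops. -/
def RamProg.cost : RamProg → ℕ
  | .seq p q => p.cost + q.cost
  | .ite _ _ p q => max p.cost q.cost + 1
  | _ => 1

/-- The weakest precondition of a program without loops. -/
def RamProg.wp (B : ℕ) : RamProg → (RamState → Prop) → RamState → Prop
  | .skip, Q, s => Q s
  | .const x k, Q, s => k ≤ B ∧ Q (s.setReg x k)
  | .copy x y, Q, s => s.reg y ≤ B ∧ Q (s.setReg x (s.reg y))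
  | .arith o x y z, Q, s =>
      o.eval (s.reg y) (s.reg z) ≤ B ∧ Q (s.setReg x (o.eval (s.reg y) (s.reg z)))
  | .load x a y, Q, s => s.arr a (s.reg y) ≤ B ∧ Q (s.setReg x (s.arr a (s.reg y)))
  | .store a x y, Q, s => s.reg y ≤ B ∧ Q (s.setArr a (s.reg x) (s.reg y))
  | .seq p q, Q, s => p.wp B (q.wp B Q) s
  | .ite x y p q, Q, s => (s.reg x < s.reg y → p.wp B Q s) ∧ (¬ s.reg x < s.reg y → q.wp B Q s)
  | .loop _ _ _, _, _ => False

theorem Runs.of_wp {B : ℕ} {p : RamProg} {s : RamState} {Q : RamState → Prop}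
    (h : p.wp B Q s) : Runs B p s p.cost Q := by
  induction p generalizing s Q with
  | skip => exact ⟨_, _, .skip s, le_rfl, h⟩
  | const x k => exact ⟨_, _, .const s x k h.1, le_rfl, h.2⟩
  | copy x y => exact ⟨_, _, .copy s x y h.1, le_rfl, h.2⟩
  | arith o x y z => exact ⟨_, _, .arith s o x y z h.1, le_rfl, h.2⟩
  | load x a y => exact ⟨_, _, .load s x a y h.1, le_rfl, h.2⟩
  | store a x y => exact ⟨_, _, .store s a x y h.1, le_rfl, h.2⟩
  | seq p q ihp ihq => exact (ihp h).seq fun s' hs' => ihq hs'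
  | ite x y p q ihp ihq =>
    exact Runs.ite (fun hlt => (ihp (h.1 hlt)).mono (le_max_left _ _) fun _ => id)
      fun hlt => (ihq (h.2 hlt)).mono (le_max_right _ _) fun _ => id
  | loop => exact h.elim

theorem RamState.reg_setReg (s : RamState) (x k y : ℕ) :
    (s.setReg x k).reg y = if y = x then k else s.reg y := by
  simp [RamState.setReg, Function.update_apply]

theorem RamState.arr_setReg (s : RamState) (x k : ℕ) : (s.setReg x k).arr = s.arr := rfl

theorem RamState.reg_setArr (s : RamState) (a j k : ℕ) : (s.setArr a j k).reg = s.reg := rfl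

theorem RamState.arr_setArr (s : RamState) (a j k b : ℕ) :
    (s.setArr a j k).arr b = if b = a then Function.update (s.arr a) j k else s.arr b := by
  simp [RamState.setArr, Function.update_apply]

/-! ### Arrays: insertion and merging -/

/-- The first `n` cells of the array `P` hold a permutation of the numbers below `n`. -/
def IsArrangement (n : ℕ) (P : ℕ → ℕ) : Prop :=
  (∀ l < n, P l < n) ∧ ∀ l < n, ∀ l' < n, P l = P l' → l = l'

theorem IsArrangement.swap {n : ℕ} {P : ℕ → ℕ} (h : IsArrangement n P) {i j : ℕ} (hi : i < n)
    (hj : j < n) : IsArrangement n (Function.update (Function.update P i (P j)) j (P i)) := by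
  obtain ⟨h1, h2⟩ := h
  constructor
  · intro l hl
    simp only [Function.update_apply]
    split_ifs <;> simp_all
  · intro l hl l' hl' h
    simp only [Function.update_apply] at h
    have := h2 l hl l' hl'
    have := h2 l hl j hj
    have := h2 l hl i hi
    have := h2 i hi l' hl'
    have := h2 j hj l' hl'
    have := h2 i hi j hj
    grind

theorem IsArrangement.exists_perm {n : ℕ} {P : ℕ → ℕ} (h : IsArrangement n P) :
    ∃ σ : Equiv.Perm (Fin n), ∀ j : Fin n, P j = σ j := by
  have hinj : Function.Injective fun j : Fin n => (⟨P j, h.1 j j.2⟩ : Fin n) := fun a b hab =>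
    Fin.ext (h.2 a a.2 b b.2 (Fin.mk.inj hab))
  exact ⟨Equiv.ofBijective _ (Finite.injective_iff_bijective.1 hinj), fun j => rfl⟩

/-- In the course of an insertion, the first `i` cells of `P` are sorted by `κ`, and the first `j` of
them do not exceed the cell `i`. -/
def InsertInv (κ P : ℕ → ℕ) (i j : ℕ) : Prop :=
  (∀ a b, a ≤ b → b < i → κ (P a) ≤ κ (P b)) ∧ ∀ a < j, κ (P a) ≤ κ (P i)

/-- The insertion scans from the left, and cell `i` serves as a buffer for the displaced element.
What enters cell `j` is at least everything before it and less than what it displaces, so the prefix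
stays sorted. -/
theorem InsertInv.swap {κ P : ℕ → ℕ} {i j : ℕ} (h : InsertInv κ P i j) (hj : j < i)
    (hlt : κ (P i) < κ (P j)) :
    InsertInv κ (Function.update (Function.update P i (P j)) j (P i)) i (j + 1) := by
  obtain ⟨h1, h2⟩ := h
  refine ⟨fun a b hab hb => ?_, fun a ha => ?_⟩
  · have := h1 a b hab hb
    have := h2 a
    have := h1 j b
    simp only [Function.update_apply]
    grind
  · have := h1 a j
    simp only [Function.update_apply]
    grind

theorem InsertInv.step {κ P : ℕ → ℕ} {i j : ℕ} (h : InsertInv κ P i j)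
    (hle : κ (P j) ≤ κ (P i)) : InsertInv κ P i (j + 1) := by
  refine ⟨h.1, fun a ha => ?_⟩
  rcases Nat.lt_succ_iff_lt_or_eq.1 ha with h' | rfl
  · exact h.2 a h'
  · exact hle

/-- After a complete scan the buffer holds a largest element of the extended prefix. -/
theorem InsertInv.next {κ P : ℕ → ℕ} {i : ℕ} (h : InsertInv κ P i i) :
    InsertInv κ P (i + 1) 0 := by
  refine ⟨fun a b hab hb => ?_, fun a ha => by omega⟩
  rcases Nat.lt_succ_iff_lt_or_eq.1 hb with h' | rfl
  · exact h.1 a b hab h'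
  · rcases hab.lt_or_eq with h' | rfl
    · exact h.2 a h'
    · exact le_rfl

/-- In the course of merging the runs `[i, S)` and `[S, n)` of `Q`, the elements before
the positions `a` and `b` of the two runs have been written to the cells of `P` up to `o`. -/
structure MergeInv (κ Q : ℕ → ℕ) (n i S : ℕ) (P : ℕ → ℕ) (a b o : ℕ) : Prop where
  le_a : i ≤ a
  a_le : a ≤ S
  le_b : S ≤ b
  b_le : b ≤ n
  add_eq : a + b = o + S
  before : ∀ l < i, P l = Q l
  source : ∀ l, i ≤ l → l < o → ∃ g, P l = Q g ∧ (i ≤ g ∧ g < a ∨ S ≤ g ∧ g < b)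
  inj : ∀ l l', i ≤ l → l < l' → l' < o → P l ≠ P l'
  sorted : ∀ l l', i ≤ l → l < l' → l' < o → κ (P l) ≤ κ (P l')
  le_rest : ∀ l g, i ≤ l → l < o → (a ≤ g ∧ g < S ∨ b ≤ g ∧ g < n) → κ (P l) ≤ κ (Q g)

theorem MergeInv.step {κ Q P : ℕ → ℕ} {n i S a b o a' b' g : ℕ} (h : MergeInv κ Q n i S P a b o)
    (hQ : IsArrangement n Q) (hg : a < S ∧ a' = a + 1 ∧ b' = b ∧ g = a ∨
      b < n ∧ a' = a ∧ b' = b + 1 ∧ g = b)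
    (hmin : ∀ g', (a ≤ g' ∧ g' < S ∨ b ≤ g' ∧ g' < n) → κ (Q g) ≤ κ (Q g')) :
    MergeInv κ Q n i S (Function.update P o (Q g)) a' b' (o + 1) := by
  obtain ⟨h1, h2, h3, h4, h5, h6, h7, h8, h9, h10⟩ := h
  have hgn : g < n := by omega
  -- Cells already written come from consumed positions of `Q`, whereas `g` is the head of a run;
  -- injectivity of `Q` separates the values.
  have hnew : ∀ l, i ≤ l → l < o → P l ≠ Q g := fun l hl hlo he => by
    obtain ⟨g', hg1, hg2⟩ := h7 l hl hlo
    have := hQ.2 g' (by omega) g hgn (hg1.symm.trans he)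
    omega
  have hle : ∀ l, i ≤ l → l < o → κ (P l) ≤ κ (Q g) := fun l hl hlo =>
    h10 l g hl hlo (by omega)
  have hold : ∀ l, l < o → Function.update P o (Q g) l = P l := fun l hl =>
    Function.update_of_ne (by omega) _ _
  have hlast : Function.update P o (Q g) o = Q g := Function.update_self _ _ _
  refine ⟨by omega, by omega, by omega, by omega, by omega, ?_, ?_, ?_, ?_, ?_⟩
  · intro l hl
    rw [hold l (by omega), h6 l hl]
  · intro l hl hlo
    rcases Nat.lt_succ_iff_lt_or_eq.1 hlo with h' | rfl
    · obtain ⟨g', hg1, hg2⟩ := h7 l hl h'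
      exact ⟨g', by rw [hold l h', hg1], by omega⟩
    · exact ⟨g, hlast, by omega⟩
  · intro l l' hl hll hlo
    rw [hold l (by omega)]
    rcases Nat.lt_succ_iff_lt_or_eq.1 hlo with h' | rfl
    · rw [hold l' h']; exact h8 l l' hl hll h'
    · rw [hlast]; exact hnew l hl hll
  · intro l l' hl hll hlo
    rw [hold l (by omega)]
    rcases Nat.lt_succ_iff_lt_or_eq.1 hlo with h' | rfl
    · rw [hold l' h']; exact h9 l l' hl hll h'
    · rw [hlast]; exact hle l hl hll
  · intro l g' hl hlo hg'
    rcases Nat.lt_succ_iff_lt_or_eq.1 hlo with h' | rfl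
    · rw [hold l h']; exact h10 l g' hl h' (by omega)
    · rw [hlast]; exact hmin g' (by omega)

theorem MergeInv.isArrangement {κ Q P : ℕ → ℕ} {n i S a b : ℕ}
    (h : MergeInv κ Q n i S P a b n) (hQ : IsArrangement n Q) : IsArrangement n P := by
  -- Sources of cells before `i` are the cells themselves and the other sources are at least `i`, so
  -- a collision could only occur inside the merged part, where `inj` forbids it.
  have hsrc : ∀ l < n, ∃ g < n, P l = Q g ∧ (l < i → g = l) ∧ (i ≤ l → i ≤ g) := fun l hl => by
    have := h.le_a; have := h.a_le; have := h.le_b; have := h.b_le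
    by_cases hli : l < i
    · exact ⟨l, hl, h.before l hli, fun _ => rfl, fun _ => by omega⟩
    · obtain ⟨g, h1, h2⟩ := h.source l (by omega) hl
      exact ⟨g, by omega, h1, fun _ => by omega, fun _ => by omega⟩
  constructor
  · intro l hl
    obtain ⟨g, hg, h1, -⟩ := hsrc l hl
    rw [h1]
    exact hQ.1 g hg
  · suffices hlt : ∀ l l', l < l' → l' < n → P l ≠ P l' by
      intro l hl l' hl' he
      rcases lt_trichotomy l l' with h' | h' | h'
      · exact absurd he (hlt l l' h' hl')
      · exact h'
      · exact absurd he.symm (hlt l' l h' hl)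
    intro l l' hll hl' he
    by_cases hli : i ≤ l
    · exact h.inj l l' hli hll hl' he
    · obtain ⟨g, hg, h1, h2, h3⟩ := hsrc l (by omega)
      obtain ⟨g', hg', h1', h2', h3'⟩ := hsrc l' hl'
      have := hQ.2 g hg g' hg' (by rw [← h1, ← h1', he])
      omega

/-- The key by which the vertices are merged orders the pairs `(a, d)` with `d ≤ a`
lexicographically. -/
theorem sq_add_le_sq_add_iff {a d a' d' : ℕ} (h : d ≤ a) (h' : d' ≤ a') :
    a * a + d ≤ a' * a' + d' ↔ a < a' ∨ a = a' ∧ d ≤ d' := by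
  constructor
  · intro hle
    rcases lt_trichotomy a a' with hlt | rfl | hlt
    · exact Or.inl hlt
    · exact Or.inr ⟨rfl, by omega⟩
    · nlinarith
  · rintro (hlt | ⟨rfl, hle⟩)
    · nlinarith
    · omega

/-! ### The program

Array `0` holds the prescribed outdegrees, array `1` the adjacency matrix, array `2` the current
arrangement, array `3` the sums of prescribed outdegree and current indegree, and array `4` a copy
of the arrangement that is used for merging. Register `1` holds the length, register `3` the number
one, and register `4` the index of the main loop. -/

namespace RamProg

/-- Set up the constants. -/
def setup : RamProg := .seq (.copy 1 0) (.seq (.const 3 1) (.const 2 0))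

/-- Initialize the arrangement and the sums. -/
def initBody : RamProg :=
  .seq (.load 5 0 2) <| .seq (.store 3 2 5) <| .seq (.store 2 2 2) (.arith .add 2 2 3)

/-- Compare the cells `4` and `2` of the arrangement in an insertion. -/
def insertBody : RamProg :=
  .seq (.load 5 2 4) <| .seq (.load 6 2 2) <| .seq (.load 7 0 5) <| .seq (.load 8 0 6) <|
  .seq (.ite 7 8 (.seq (.store 2 4 6) (.store 2 2 5)) .skip) (.arith .add 2 2 3)

/-- One round of the insertion sort. -/
def sortBody : RamProg :=
  .seq (.const 2 0) <| .seq (.loop 2 4 insertBody) (.arith .add 4 4 3)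

/-- Count the vertices of outdegree zero. -/
def zeroBody : RamProg :=
  .seq (.load 5 2 2) <| .seq (.load 7 0 5) <|
  .seq (.ite 7 3 (.arith .add 4 4 3) .skip) (.arith .add 2 2 3)

/-- Select the next vertex. -/
def selectVertex : RamProg :=
  .seq (.load 10 2 4) <| .seq (.load 11 0 10) <| .seq (.arith .mul 14 10 1) <|
  .seq (.const 12 0) <| .seq (.const 13 0) (.const 2 0)

/-- Connect the selected vertex to the vertex in position `2` if that is allowed and necessary. -/
def connectBody : RamProg :=
  .seq (.load 6 2 2) <| .seq (.store 4 2 6) <|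
  .seq (.ite 12 11
    (.seq (.arith .add 13 2 3) <| .seq (.arith .mul 7 6 1) <| .seq (.arith .add 7 7 10) <|
      .seq (.load 7 1 7) <| .seq (.arith .sub 8 6 10) <| .seq (.arith .sub 9 10 6) <|
      .seq (.arith .add 8 8 9) <| .seq (.arith .sub 8 3 8) <| .seq (.arith .add 7 7 8) <|
      .ite 7 3
        (.seq (.arith .add 7 14 6) <| .seq (.store 1 7 3) <| .seq (.load 7 3 6) <|
          .seq (.arith .add 7 7 3) <| .seq (.store 3 6 7) (.arith .add 12 12 3))
        .skip)
    .skip)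
  (.arith .add 2 2 3)

/-- Prepare the merging. -/
def mergeSetup : RamProg :=
  .seq (.arith .add 16 4 3) <| .seq (.arith .sub 17 13 16) <| .seq (.arith .add 17 17 16) <|
  .seq (.copy 13 17) (.copy 18 16)

/-- Decide by register `19` which of the two runs comes next. -/
def mergeChoose : RamProg :=
  .seq (.const 19 0) <|
  .ite 16 13
    (.ite 17 1
      (.seq (.load 5 4 16) <| .seq (.load 6 4 17) <|
        .seq (.load 7 3 5) <| .seq (.arith .mul 7 7 7) <| .seq (.load 8 0 5) <|
        .seq (.arith .add 7 7 8) <|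
        .seq (.load 8 3 6) <| .seq (.arith .mul 8 8 8) <| .seq (.load 9 0 6) <|
        .seq (.arith .add 8 8 9) <|
        .ite 8 7 .skip (.const 19 1))
      (.const 19 1))
    .skip

/-- Write the next element of the merged runs. -/
def mergeBody : RamProg :=
  .seq mergeChoose <|
  .seq (.ite 19 3 (.seq (.load 5 4 17) (.arith .add 17 17 3))
    (.seq (.load 5 4 16) (.arith .add 16 16 3))) <|
  .seq (.store 2 18 5) (.arith .add 18 18 3)

/-- One round of the main loop. -/
def mainBody : RamProg :=
  .seq selectVertex <| .seq (.loop 2 1 connectBody) <|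
  .ite 12 11 (.seq (.const 15 0) (.copy 4 1))
    (.seq mergeSetup <| .seq (.loop 18 1 mergeBody) (.arith .add 4 4 3))

/-- The greedy algorithm. -/
def greedy : RamProg :=
  .seq setup <| .seq (.loop 2 1 initBody) <|
  .seq (.const 4 0) <| .seq (.loop 4 1 sortBody) <|
  .seq (.seq (.const 4 0) (.const 2 0)) <| .seq (.loop 2 1 zeroBody) <|
  .seq (.const 15 1) <| .seq (.loop 4 1 mainBody) (.copy 0 15)

end RamProg

open RamProg

/-! ### Verification of the initial phases -/

/-- The input array. -/
def inputArr {n : ℕ} (d : OVS n) : ℕ → ℕ := (ramInput d).arr 0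

theorem inputArr_coe {n : ℕ} (d : OVS n) (v : Fin n) : inputArr d v = d v := by
  simp [inputArr, ramInput]

theorem inputArr_le {n : ℕ} (d : OVS n) (j : ℕ) : inputArr d j ≤ Finset.univ.sup d := by
  by_cases h : j < n
  · simpa [inputArr, ramInput, h] using Finset.le_sup (f := d) (Finset.mem_univ (⟨j, h⟩ : Fin n))
  · simp [inputArr, ramInput, h]

/-- The word bound. -/
def wordBound {n : ℕ} (d : OVS n) : ℕ := (n + Finset.univ.sup d + 2) ^ 2

theorem add_le_wordBound {n : ℕ} (d : OVS n) : n + Finset.univ.sup d + 2 ≤ wordBound d := by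
  unfold wordBound
  nlinarith

theorem index_le_wordBound {n : ℕ} (d : OVS n) {u v : ℕ} (hu : u < n) (hv : v < n) :
    u * n + v ≤ wordBound d := by
  have h1 : (u + 1) * n ≤ n * n := Nat.mul_le_mul_right n hu
  have h2 : n * n ≤ (n + Finset.univ.sup d + 2) * (n + Finset.univ.sup d + 2) := by
    gcongr <;> omega
  rw [wordBound, sq]
  linarith

theorem key_le_wordBound {n : ℕ} (d : OVS n) {a e : ℕ} (ha : a ≤ n + Finset.univ.sup d)
    (he : e ≤ Finset.univ.sup d) : a * a + e ≤ wordBound d := by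
  unfold wordBound
  nlinarith

/-- The contents of the cells that do not change in the initial phases. -/
structure InitState {n : ℕ} (d : OVS n) (s : RamState) : Prop where
  len : s.reg 1 = n
  one : s.reg 3 = 1
  input : s.arr 0 = inputArr d
  adj : s.arr 1 = fun _ => 0

/-- The sums are those of the graph without edges. -/
def SumInit {n : ℕ} (d : OVS n) (s : RamState) : Prop := ∀ l < n, s.arr 3 l = inputArr d l

theorem runs_setup {n : ℕ} (d : OVS n) :
    Runs (wordBound d) setup (ramInput d) setup.cost fun s => InitState d s ∧ s.reg 2 = 0 := by
  have := add_le_wordBound d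
  refine Runs.of_wp ?_
  simp only [setup, wp, RamState.reg_setReg]
  refine ⟨by simp [ramInput]; omega, by omega, by omega, ⟨by simp [RamState.reg_setReg, ramInput],
    by simp [RamState.reg_setReg], rfl, ?_⟩, by simp⟩
  funext j
  simp [RamState.arr_setReg, ramInput]

theorem runs_init {n : ℕ} (d : OVS n) {s : RamState} (hs : InitState d s) (h2 : s.reg 2 = 0) :
    Runs (wordBound d) (.loop 2 1 initBody) s ((initBody.cost + 1) * n + 1) fun s =>
      InitState d s ∧ SumInit d s ∧ ∀ l < n, s.arr 2 l = l := by
  refine (Runs.loop n (fun s => InitState d s ∧ s.reg 2 ≤ n ∧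
    ∀ l < s.reg 2, s.arr 3 l = inputArr d l ∧ s.arr 2 l = l) (fun s h => h.1.len) ?_
    ⟨hs, by omega, by omega⟩).mono le_rfl ?_
  · rintro s ⟨⟨len, one, input, adj⟩, hle, hl⟩ hlt
    have := add_le_wordBound d
    have hd := inputArr_le d (s.reg 2)
    refine Runs.of_wp ?_
    simp [initBody, wp, RamState.reg_setReg, RamState.arr_setReg, RamState.reg_setArr,
      RamState.arr_setArr, RamOp.eval, one, input]
    refine ⟨by omega, by omega, by omega, ⟨?_, ?_, ?_, ?_⟩, by omega, fun l hlt' => ?_⟩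
    any_goals simp [RamState.reg_setReg, RamState.arr_setReg, RamState.reg_setArr,
      RamState.arr_setArr, len, one, input, adj]
    have := hl l
    simp only [Function.update_apply]
    split_ifs <;> grind
  · rintro s ⟨⟨h1, -, h2⟩, h3⟩
    exact ⟨h1, fun l hl => (h2 l (by omega)).1, fun l hl => (h2 l (by omega)).2⟩

theorem runs_insert {n : ℕ} (d : OVS n) {s : RamState} (hs : InitState d s) (hsum : SumInit d s)
    (harr : IsArrangement n (s.arr 2)) {i : ℕ} (hi : i < n) (h4 : s.reg 4 = i)
    (h2 : s.reg 2 = 0) (hins : InsertInv (inputArr d) (s.arr 2) i 0) :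
    Runs (wordBound d) (.loop 2 4 insertBody) s ((insertBody.cost + 1) * i + 1) fun s =>
      InitState d s ∧ SumInit d s ∧ IsArrangement n (s.arr 2) ∧ s.reg 4 = i ∧
      InsertInv (inputArr d) (s.arr 2) i i := by
  refine (Runs.loop i (fun s => (InitState d s ∧ SumInit d s ∧ IsArrangement n (s.arr 2) ∧
    s.reg 4 = i) ∧ s.reg 2 ≤ i ∧ InsertInv (inputArr d) (s.arr 2) i (s.reg 2))
    (fun s h => h.1.2.2.2) ?_ ⟨⟨hs, hsum, harr, h4⟩, by omega, h2 ▸ hins⟩).mono le_rfl ?_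
  · rintro s ⟨⟨⟨len, one, input, adj⟩, hsum, harr, h4⟩, hle, hins⟩ hlt
    have := add_le_wordBound d
    have hd := inputArr_le d
    have hi' := harr.1 i hi
    have hj' := harr.1 (s.reg 2) (by omega)
    have hd1 := hd (s.arr 2 i)
    have hd2 := hd (s.arr 2 (s.reg 2))
    refine Runs.of_wp ?_
    simp [insertBody, wp, RamState.reg_setReg, RamState.arr_setReg, RamState.reg_setArr,
      RamState.arr_setArr, RamOp.eval, one, input, h4]
    refine ⟨by omega, by omega, by omega, by omega, fun hx => ⟨by omega, by omega, by omega,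
      ⟨⟨?_, ?_, ?_, ?_⟩, ?_, ?_⟩, by omega, ?_⟩, fun hx => ⟨by omega,
      ⟨⟨?_, ?_, ?_, ?_⟩, ?_⟩, by omega, ?_⟩⟩
    any_goals simp [RamState.reg_setReg, RamState.arr_setReg, RamState.reg_setArr,
      RamState.arr_setArr, len, one, input, adj]
    · exact hsum
    · exact harr.swap hi (by omega)
    · exact hins.swap hlt hx
    · exact ⟨hsum, harr⟩
    · exact hins.step hx
  · rintro s ⟨⟨⟨h1, h2, h3, h4⟩, h5, h6⟩, h7⟩
    exact ⟨h1, h2, h3, h4, by rwa [le_antisymm h5 h7] at h6⟩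

theorem runs_sort {n : ℕ} (d : OVS n) {s : RamState} (hs : InitState d s) (hsum : SumInit d s)
    (harr : IsArrangement n (s.arr 2)) (h4 : s.reg 4 = 0) :
    Runs (wordBound d) (.loop 4 1 sortBody) s
      ((1 + ((insertBody.cost + 1) * n + 1 + 1) + 1) * n + 1) fun s =>
      InitState d s ∧ SumInit d s ∧ IsArrangement n (s.arr 2) ∧
      ∀ a b, a ≤ b → b < n → inputArr d (s.arr 2 a) ≤ inputArr d (s.arr 2 b) := by
  refine (Runs.loop n (fun s => (InitState d s ∧ SumInit d s ∧ IsArrangement n (s.arr 2)) ∧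
    s.reg 4 ≤ n ∧ InsertInv (inputArr d) (s.arr 2) (s.reg 4) 0) (fun s h => h.1.1.len) ?_
    ⟨⟨hs, hsum, harr⟩, by omega, by rw [h4]; exact ⟨by omega, by omega⟩⟩).mono le_rfl ?_
  · rintro s ⟨⟨hs, hsum, harr⟩, hle, hins⟩ hlt
    have := add_le_wordBound d
    refine Runs.seq (R := fun s' => (InitState d s' ∧ SumInit d s' ∧ s'.arr 2 = s.arr 2) ∧
      s'.reg 4 = s.reg 4 ∧ s'.reg 2 = 0) (T₁ := 1)
      (T₂ := (insertBody.cost + 1) * n + 1 + 1) (Runs.of_wp ?_) ?_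
    · obtain ⟨len, one, input, adj⟩ := hs
      simp only [wp]
      refine ⟨by omega, ⟨⟨?_, ?_, ?_, ?_⟩, hsum, ?_⟩, ?_, ?_⟩
      all_goals simp [RamState.reg_setReg, RamState.arr_setReg, len, one, input, adj]
    · rintro s' ⟨⟨hs', hsum', harr'⟩, h4', h2'⟩
      have := runs_insert d hs' hsum' (harr' ▸ harr) hlt h4' h2' (harr' ▸ hins)
      refine (this.mono (T' := (insertBody.cost + 1) * n + 1) (by gcongr) (fun _ => id)).seq ?_
      rintro s ⟨⟨len, one, input, adj⟩, hsum, harr, h4, hins⟩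
      refine Runs.of_wp ?_
      simp only [wp, RamOp.eval]
      refine ⟨by omega, ⟨⟨⟨?_, ?_, ?_, ?_⟩, hsum, harr⟩, ?_, ?_⟩, ?_⟩
      any_goals simp [RamState.reg_setReg, RamState.arr_setReg, len, one, input, adj, h4]
      · omega
      · exact hins.next
  · rintro s ⟨⟨⟨h1, h2, h3⟩, h4, h5⟩, h6⟩
    refine ⟨h1, h2, h3, fun a b hab hb => h5.1 a b hab (by omega)⟩

theorem runs_zero {n : ℕ} (d : OVS n) {s : RamState} (hs : InitState d s) (hsum : SumInit d s)
    (harr : IsArrangement n (s.arr 2))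
    (hsort : ∀ a b, a ≤ b → b < n → inputArr d (s.arr 2 a) ≤ inputArr d (s.arr 2 b))
    (h2 : s.reg 2 = 0) (h4 : s.reg 4 = 0) :
    Runs (wordBound d) (.loop 2 1 zeroBody) s ((zeroBody.cost + 1) * n + 1) fun s =>
      InitState d s ∧ SumInit d s ∧ IsArrangement n (s.arr 2) ∧
      (∀ a b, a ≤ b → b < n → inputArr d (s.arr 2 a) ≤ inputArr d (s.arr 2 b)) ∧
      s.reg 4 ≤ n ∧ (∀ l < s.reg 4, inputArr d (s.arr 2 l) = 0) ∧
      (∀ l < n, s.reg 4 = l → inputArr d (s.arr 2 l) ≠ 0) := by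
  refine (Runs.loop n (fun s => (InitState d s ∧ SumInit d s ∧ IsArrangement n (s.arr 2) ∧
      (∀ a b, a ≤ b → b < n → inputArr d (s.arr 2 a) ≤ inputArr d (s.arr 2 b))) ∧
      s.reg 2 ≤ n ∧ s.reg 4 ≤ s.reg 2 ∧ (∀ l < s.reg 4, inputArr d (s.arr 2 l) = 0) ∧
      (∀ l < s.reg 2, s.reg 4 = l → inputArr d (s.arr 2 l) ≠ 0)) (fun s h => h.1.1.len) ?_
    ⟨⟨hs, hsum, harr, hsort⟩, by omega, by omega, by omega, by omega⟩).mono le_rfl ?_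
  · rintro s ⟨⟨⟨len, one, input, adj⟩, hsum, harr, hsort⟩, hle, hle', hz, hnz⟩ hlt
    have := add_le_wordBound d
    have hj' := harr.1 (s.reg 2) (by omega)
    have hd2 := inputArr_le d (s.arr 2 (s.reg 2))
    -- In a sorted arrangement the zeros form a prefix: once the counter lags behind the scan, it
    -- points at a nonzero entry, and no zero can follow.
    have heq : inputArr d (s.arr 2 (s.reg 2)) = 0 → s.reg 4 = s.reg 2 := fun hx => by
      by_contra hne
      have h1 := hnz (s.reg 4) (by omega) rfl
      have h2 := hsort (s.reg 4) (s.reg 2) hle' hlt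
      omega
    refine Runs.of_wp ?_
    simp [zeroBody, wp, RamState.reg_setReg, RamState.arr_setReg,
      RamOp.eval, one, input]
    refine ⟨by omega, by omega, fun hx => ⟨by omega, by omega,
      ⟨⟨?_, ?_, ?_, ?_⟩, hsum, harr, hsort⟩, by omega, by omega, ?_, ?_⟩, fun hx => ⟨by omega,
      ⟨⟨?_, ?_, ?_, ?_⟩, hsum, harr, hsort⟩, by omega, by omega, hz, ?_⟩⟩
    any_goals simp [RamState.reg_setReg, RamState.arr_setReg,
      len, one, input, adj]
    · intro l hl
      rcases hl.lt_or_eq with h' | h'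
      · exact hz l h'
      · rw [h', heq hx, hx]
    · have := heq hx
      omega
    · intro l hl hl'
      rcases hl.lt_or_eq with h' | rfl
      · exact hnz l h' hl'
      · exact hx
  · rintro s ⟨⟨⟨h1, h2, h3, h4⟩, h5, h6, h7, h8⟩, h9⟩
    exact ⟨h1, h2, h3, h4, by omega, h7, fun l hl => h8 l (by omega)⟩

/-! ### Verification of the merging -/

/-- The contents of the cells that do not change while two runs are merged. -/
structure MergeState {n : ℕ} (d : OVS n) (i S : ℕ) (E A Q : ℕ → ℕ) (s : RamState) : Prop where
  len : s.reg 1 = n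
  one : s.reg 3 = 1
  idx : s.reg 4 = i
  split : s.reg 13 = S
  ok : s.reg 15 = 1
  input : s.arr 0 = inputArr d
  adj : s.arr 1 = E
  sum : s.arr 3 = A
  copy : s.arr 4 = Q

theorem MergeState.setReg {n : ℕ} {d : OVS n} {i S : ℕ} {E A Q : ℕ → ℕ} {s : RamState}
    (h : MergeState d i S E A Q s) {x : ℕ} (k : ℕ) (hx : x ∉ [1, 3, 4, 13, 15]) :
    MergeState d i S E A Q (s.setReg x k) := by
  obtain ⟨len, one, idx, split, ok, input, adj, sum, copy⟩ := h
  simp only [List.mem_cons, List.not_mem_nil, or_false, not_or] at hx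
  constructor <;> simp [RamState.reg_setReg, RamState.arr_setReg, *] <;> omega

theorem MergeState.setArr {n : ℕ} {d : OVS n} {i S : ℕ} {E A Q : ℕ → ℕ} {s : RamState}
    (h : MergeState d i S E A Q s) (j k : ℕ) : MergeState d i S E A Q (s.setArr 2 j k) := by
  obtain ⟨len, one, idx, split, ok, input, adj, sum, copy⟩ := h
  constructor <;> simp [RamState.reg_setArr, RamState.arr_setArr, *]

/-- The key by which the vertices are merged. -/
def mergeKey {n : ℕ} (d : OVS n) (A : ℕ → ℕ) (w : ℕ) : ℕ := A w * A w + inputArr d w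

theorem runs_merge {n : ℕ} (d : OVS n) {i S : ℕ} {E A Q : ℕ → ℕ} (hQ : IsArrangement n Q)
    (hA : ∀ w < n, A w ≤ n + Finset.univ.sup d)
    (hrun₁ : ∀ g g', i < g → g ≤ g' → g' < S → mergeKey d A (Q g) ≤ mergeKey d A (Q g'))
    (hrun₂ : ∀ g g', S ≤ g → g ≤ g' → g' < n → mergeKey d A (Q g) ≤ mergeKey d A (Q g'))
    {s : RamState} (hs : MergeState d i S E A Q s)
    (hm : MergeInv (mergeKey d A) Q n (i + 1) S (s.arr 2) (s.reg 16) (s.reg 17) (s.reg 18)) :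
    Runs (wordBound d) (.loop 18 1 mergeBody) s ((mergeBody.cost + 1) * n + 1) fun s =>
      MergeState d i S E A Q s ∧
      ∃ a b, MergeInv (mergeKey d A) Q n (i + 1) S (s.arr 2) a b n := by
  refine (Runs.loop n (fun s => MergeState d i S E A Q s ∧
    MergeInv (mergeKey d A) Q n (i + 1) S (s.arr 2) (s.reg 16) (s.reg 17) (s.reg 18))
    (fun s h => h.1.len) ?_ ⟨hs, hm⟩).mono le_rfl ?_
  swap
  · rintro s ⟨⟨h1, h2⟩, h3⟩
    refine ⟨h1, s.reg 16, s.reg 17, ?_⟩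
    have := h2.add_eq; have := h2.a_le; have := h2.b_le
    have heq : s.reg 18 = n := by omega
    rwa [heq] at h2
  rintro s ⟨hs, hm⟩ hlt
  have hb := add_le_wordBound d
  have hle_a := hm.le_a
  have ha_le := hm.a_le
  have hle_b := hm.le_b
  have hb_le := hm.b_le
  have hadd := hm.add_eq
  have hAB : ∀ w < n, A w * A w + inputArr d w ≤ wordBound d := fun w hw =>
    key_le_wordBound d (hA w hw) (inputArr_le d w)
  have choose : Runs (wordBound d) mergeChoose s mergeChoose.cost fun s' =>
      MergeState d i S E A Q s' ∧ s'.arr 2 = s.arr 2 ∧ s'.reg 16 = s.reg 16 ∧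
      s'.reg 17 = s.reg 17 ∧ s'.reg 18 = s.reg 18 ∧
      (s'.reg 19 = 1 ∧ s.reg 16 < S ∧
        (s.reg 17 < n → mergeKey d A (Q (s.reg 16)) ≤ mergeKey d A (Q (s.reg 17))) ∨
      s'.reg 19 = 0 ∧ s.reg 17 < n ∧
        (s.reg 16 < S → mergeKey d A (Q (s.reg 17)) ≤ mergeKey d A (Q (s.reg 16)))) := by
    obtain ⟨len, one, idx, split, ok, input, adj, sum, copy⟩ := id hs
    refine Runs.of_wp ?_
    simp [mergeChoose, wp, RamState.reg_setReg, RamState.arr_setReg, RamOp.eval, len, split, input,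
      sum, copy]
    refine ⟨fun h1 => ⟨fun h2 => ?_, fun h2 => ⟨by omega, ?_, h1, by omega⟩⟩,
      fun h1 => ⟨?_, by omega, by omega⟩⟩
    · have hp := hQ.1 (s.reg 16) (by omega)
      have hq := hQ.1 (s.reg 17) (by omega)
      have := hA _ hp
      have := hA _ hq
      have := hAB _ hp
      have := hAB _ hq
      have := inputArr_le d (Q (s.reg 16))
      have := inputArr_le d (Q (s.reg 17))
      refine ⟨by omega, by omega, by omega, by omega, by omega, by omega, by omega, by omega,
        by omega, by omega, fun hx => ⟨?_, h2, fun _ => hx.le⟩,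
        fun hx => ⟨by omega, ?_, h1, fun _ => hx⟩⟩ <;>
      · repeat refine MergeState.setReg ?_ _ (by decide)
        exact hs
    · exact (hs.setReg _ (by decide)).setReg _ (by decide)
    · exact hs.setReg _ (by decide)
  refine choose.seq (T₂ := _) ?_
  rintro s' ⟨hs', harr, h16, h17, h18, hch⟩
  obtain ⟨len, one, idx, split, ok, input, adj, sum, copy⟩ := id hs'
  refine Runs.of_wp ?_
  simp only [wp, RamState.reg_setReg, RamState.arr_setReg, RamState.reg_setArr,
    RamState.arr_setArr, RamOp.eval, Nat.reduceEqDiff, reduceIte, one, copy, harr, h16, h17, h18]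
  -- As each run is sorted, being minimal among all remaining elements reduces to comparison with
  -- the heads of the two runs.
  have next : ∀ {a' b' g}, (s.reg 16 < S ∧ a' = s.reg 16 + 1 ∧ b' = s.reg 17 ∧ g = s.reg 16 ∨
      s.reg 17 < n ∧ a' = s.reg 16 ∧ b' = s.reg 17 + 1 ∧ g = s.reg 17) →
      (s.reg 16 < S → mergeKey d A (Q g) ≤ mergeKey d A (Q (s.reg 16))) →
      (s.reg 17 < n → mergeKey d A (Q g) ≤ mergeKey d A (Q (s.reg 17))) →
      MergeInv (mergeKey d A) Q n (i + 1) S (Function.update (s.arr 2) (s.reg 18) (Q g)) a' b'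
        (s.reg 18 + 1) := fun hg h1 h2 => hm.step hQ hg fun g' hg' => by
    rcases hg' with ⟨h3, h4⟩ | ⟨h3, h4⟩
    · exact (h1 (by omega)).trans (hrun₁ _ _ (by omega) h3 h4)
    · exact (h2 (by omega)).trans (hrun₂ _ _ (by omega) h3 h4)
  refine ⟨fun hf => ?_, fun hf => ?_⟩
  · obtain ⟨h1, h2⟩ : s.reg 17 < n ∧ (s.reg 16 < S →
        mergeKey d A (Q (s.reg 17)) ≤ mergeKey d A (Q (s.reg 16))) := by
      rcases hch with h | h
      · omega
      · exact h.2
    have := hQ.1 (s.reg 17) h1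
    refine ⟨by omega, by omega, by omega, by omega, ⟨?_, ?_⟩, by omega⟩
    · exact (((hs'.setReg _ (by decide)).setReg _ (by decide)).setArr _ _).setReg _ (by decide)
    · exact next (Or.inr ⟨h1, rfl, rfl, rfl⟩) h2 fun _ => le_rfl
  · obtain ⟨h1, h2⟩ : s.reg 16 < S ∧ (s.reg 17 < n →
        mergeKey d A (Q (s.reg 16)) ≤ mergeKey d A (Q (s.reg 17))) := by
      rcases hch with h | h
      · exact h.2
      · omega
    have := hQ.1 (s.reg 16) (by omega)
    refine ⟨by omega, by omega, by omega, by omega, ⟨?_, ?_⟩, by omega⟩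
    · exact (((hs'.setReg _ (by decide)).setReg _ (by decide)).setArr _ _).setReg _ (by decide)
    · exact next (Or.inl ⟨h1, rfl, rfl, rfl⟩) (fun _ => le_rfl) h2

/-! ### Adjacency matrices and the connection of a selected vertex -/

/-- The array `E` holds the adjacency matrix of `G`. -/
def AdjArray {n : ℕ} (E : ℕ → ℕ) (G : Digraph (Fin n)) : Prop :=
  ∀ u v : Fin n, (G.Adj u v → E (u * n + v) = 1) ∧ (¬ G.Adj u v → E (u * n + v) = 0)

theorem AdjArray.connect_singleton {n : ℕ} {E : ℕ → ℕ} {G : Digraph (Fin n)} (h : AdjArray E G)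
    (v w : Fin n) :
    AdjArray (Function.update E (v * n + w) 1) (connect G v {w}) := by
  intro a b
  have hiff : (a : ℕ) * n + b = v * n + w ↔ a = v ∧ b = w := by
    constructor
    · intro he
      have h1 : (a : ℕ) = v := by
        have := congrArg (· / n) he
        simpa [Nat.mul_comm _ n, Nat.mul_add_div a.pos, Nat.div_eq_of_lt b.2,
          Nat.div_eq_of_lt w.2] using this
      exact ⟨Fin.ext h1, Fin.ext (by rw [h1] at he; omega)⟩
    · rintro ⟨rfl, rfl⟩; rfl
  have := h a b
  simp only [Function.update_apply, connect, Set.mem_singleton_iff, hiff]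
  by_cases hab : a = v ∧ b = w
  · simp [hab]
  · simpa [hab] using this

theorem connect_insert {n : ℕ} (G : Digraph (Fin n)) (v w : Fin n) (L : Set (Fin n)) :
    connect G v (insert w L) = connect (connect G v L) v {w} := by
  ext a b
  simp only [connect, Set.mem_insert_iff, Set.mem_singleton_iff]
  tauto

theorem connect_empty {n : ℕ} (G : Digraph (Fin n)) (v : Fin n) : connect G v ∅ = G := by
  ext a b
  simp [connect]

theorem ncard_inNbrs_connect_self {n : ℕ} {G : Digraph (Fin n)} {v w : Fin n} {L : Set (Fin n)}
    (hw : w ∈ L) (h : ¬ G.Adj v w) :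
    (inNbrs (connect G v L) w).ncard = (inNbrs G w).ncard + 1 := by
  have : inNbrs (connect G v L) w = insert v (inNbrs G w) := by
    ext a
    simp [inNbrs, connect, hw, or_comm]
  rw [this, Set.ncard_insert_of_notMem (s := inNbrs G w) h]

theorem inNbrs_connect_of_notMem {n : ℕ} {G : Digraph (Fin n)} {v w : Fin n} {L : Set (Fin n)}
    (hw : w ∉ L) : inNbrs (connect G v L) w = inNbrs G w := by
  ext a
  simp [inNbrs, connect, hw]

/-- The set of the vertices in the first `i` positions. -/
def leading {n : ℕ} (σ : Equiv.Perm (Fin n)) (i : ℕ) : Set (Fin n) :=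
  {v | ∃ j : Fin n, (j : ℕ) < i ∧ σ j = v}

theorem mem_leading {n : ℕ} {σ : Equiv.Perm (Fin n)} {i : ℕ} {v : Fin n} :
    v ∈ leading σ i ↔ (σ.symm v : ℕ) < i := by
  constructor
  · rintro ⟨j, hj, rfl⟩
    simpa using hj
  · intro h
    exact ⟨_, h, by simp⟩

/-- The allowed vertices among the first `m` positions. -/
def allowedBefore {n : ℕ} (G : Digraph (Fin n)) (σ : Equiv.Perm (Fin n)) (v : Fin n) (m : ℕ) :
    Set (Fin n) := leading σ m ∩ allowed G v

theorem leading_succ {n : ℕ} (σ : Equiv.Perm (Fin n)) (j : Fin n) :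
    leading σ (j + 1) = insert (σ j) (leading σ j) := by
  ext v
  rw [Set.mem_insert_iff, mem_leading, mem_leading, Nat.lt_succ_iff_lt_or_eq, or_comm,
    ← Equiv.symm_apply_eq, Fin.ext_iff]

theorem notMem_leading {n : ℕ} (σ : Equiv.Perm (Fin n)) (j : Fin n) : σ j ∉ leading σ j := by
  simp [mem_leading]

theorem allowedBefore_succ_of_mem {n : ℕ} {G : Digraph (Fin n)} {σ : Equiv.Perm (Fin n)}
    {v j : Fin n} (h : σ j ∈ allowed G v) :
    allowedBefore G σ v (j + 1) = insert (σ j) (allowedBefore G σ v j) := by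
  rw [allowedBefore, leading_succ, Set.insert_inter_of_mem h, allowedBefore]

theorem allowedBefore_succ_of_notMem {n : ℕ} {G : Digraph (Fin n)} {σ : Equiv.Perm (Fin n)}
    {v j : Fin n} (h : σ j ∉ allowed G v) :
    allowedBefore G σ v (j + 1) = allowedBefore G σ v j := by
  rw [allowedBefore, leading_succ, Set.insert_inter_of_notMem h, allowedBefore]

/-- The vertex `u` may precede `v` in a normal arrangement. -/
def LexLe {n : ℕ} (d : OVS n) (G : Digraph (Fin n)) (u v : Fin n) : Prop :=
  d u + (inNbrs G u).ncard < d v + (inNbrs G v).ncard ∨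
    (d u + (inNbrs G u).ncard = d v + (inNbrs G v).ncard ∧ d u ≤ d v)

/-- The state at the beginning of a round of the main loop. -/
structure MainInv {n : ℕ} (d : OVS n) (i : ℕ) (σ : Equiv.Perm (Fin n)) (G : Digraph (Fin n))
    (s : RamState) : Prop where
  len : s.reg 1 = n
  one : s.reg 3 = 1
  idx : s.reg 4 = i
  idx_le : i ≤ n
  ok : s.reg 15 = 1
  input : s.arr 0 = inputArr d
  adj : AdjArray (s.arr 1) G
  perm : ∀ j : Fin n, s.arr 2 j = σ j
  sum : ∀ w : Fin n, s.arr 3 w = d w + (inNbrs G w).ncard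
  source : ∀ u w, G.Adj u w → u ∈ leading σ i
  sorted : ∀ a b : Fin n, i ≤ a → a < b → LexLe d G (σ a) (σ b)
  cont : ∀ r, GreedyLoop d i (leading σ i) G r → GreedyRun d r

/-- The state while the vertex in position `i` is being connected. -/
structure ConnectInv {n : ℕ} (d : OVS n) (i : Fin n) (σ : Equiv.Perm (Fin n))
    (G : Digraph (Fin n)) (s : RamState) : Prop where
  len : s.reg 1 = n
  one : s.reg 3 = 1
  idx : s.reg 4 = i
  ok : s.reg 15 = 1
  vertex : s.reg 10 = σ i
  degree : s.reg 11 = d (σ i)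
  row : s.reg 14 = σ i * n
  input : s.arr 0 = inputArr d
  perm : ∀ j : Fin n, s.arr 2 j = σ j
  pos_le : s.reg 2 ≤ n
  split_le : s.reg 13 ≤ s.reg 2
  count : s.reg 12 = (allowedBefore G σ (σ i) (s.reg 13)).ncard
  count_le : s.reg 12 ≤ d (σ i)
  split_eq : s.reg 12 < d (σ i) → s.reg 13 = s.reg 2
  adj : AdjArray (s.arr 1) (connect G (σ i) (allowedBefore G σ (σ i) (s.reg 13)))
  sum : ∀ w : Fin n, s.arr 3 w =
    d w + (inNbrs (connect G (σ i) (allowedBefore G σ (σ i) (s.reg 13))) w).ncard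
  copy : ∀ l : Fin n, (l : ℕ) < s.reg 2 → s.arr 4 l = σ l

theorem ncard_inNbrs_le {n : ℕ} (G : Digraph (Fin n)) (w : Fin n) : (inNbrs G w).ncard ≤ n := by
  simpa using Set.ncard_le_card (inNbrs G w)

theorem runs_connectBody {n : ℕ} (d : OVS n) {i : Fin n} {σ : Equiv.Perm (Fin n)}
    {G : Digraph (Fin n)} (hsrc : ∀ u w, G.Adj u w → u ∈ leading σ i) {s : RamState}
    (hs : ConnectInv d i σ G s) (hlt : s.reg 2 < n) :
    Runs (wordBound d) connectBody s connectBody.cost fun s' =>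
      ConnectInv d i σ G s' ∧ s.reg 2 < s'.reg 2 := by
  obtain ⟨len, one, idx, ok, vertex, degree, row, input, perm, pos_le, split_le, count, count_le,
    split_eq, adj, sum, copy⟩ := hs
  have hb := add_le_wordBound d
  set j : Fin n := ⟨s.reg 2, hlt⟩ with hj
  have hw : s.arr 2 (s.reg 2) = σ j := perm j
  refine Runs.of_wp ?_
  simp only [connectBody, wp, RamState.reg_setReg, RamState.arr_setReg, RamState.reg_setArr,
    RamState.arr_setArr, RamOp.eval, Nat.reduceEqDiff, reduceIte, len, one, vertex, degree, row, hw]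
  have hcopy : ∀ l : Fin n, (l : ℕ) < s.reg 2 + 1 →
      Function.update (s.arr 4) (s.reg 2) (σ j : ℕ) l = σ l := fun l hl => by
    rcases Nat.lt_succ_iff_lt_or_eq.1 hl with h | h
    · rw [Function.update_of_ne h.ne, copy l h]
    · have : l = j := Fin.ext h
      rw [h, Function.update_self, this]
  have hjn := (σ j).2
  have hin := (σ i).2
  refine ⟨by omega, by omega, fun hc => ?_, fun hc => ⟨by omega, ?_, by omega⟩⟩
  swap
  · constructor
    all_goals simp only [RamState.reg_setReg, RamState.arr_setReg, RamState.reg_setArr,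
      RamState.arr_setArr, Nat.reduceEqDiff, reduceIte]
    any_goals assumption
    · omega
    · omega
  have hm := split_eq hc
  rw [hm] at adj sum count
  set L := allowedBefore G σ (σ i) (s.reg 2) with hL
  have hiL : σ i ∉ L := fun h => h.2.2 rfl
  -- The selected vertex never receives one of its own new edges, so the updated matrix can still be
  -- asked which vertices are in-neighbours of `v` in `G`.
  have hadj : (connect G (σ i) L).Adj (σ j) (σ i) ↔ G.Adj (σ j) (σ i) := by
    simp [connect, hiL]
  have hE := adj (σ j) (σ i)
  rw [hadj] at hE
  set e := s.arr 1 ((σ j : ℕ) * n + σ i) with he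
  have he1 : e ≤ 1 := by
    by_cases h : G.Adj (σ j) (σ i)
    · exact (hE.1 h).le
    · rw [hE.2 h]; omega
  -- The sum of the two truncated differences is the distance of the indices, so the second summand
  -- is `1` exactly on the diagonal, and the test excludes in-neighbours and `v` at once.
  have htest : e + (1 - ((σ j : ℕ) - σ i + ((σ i : ℕ) - σ j))) < 1 ↔ σ j ∈ allowed G (σ i) := by
    constructor
    · intro h
      refine ⟨fun h' => ?_, fun h' => ?_⟩
      · have := hE.1 h'
        omega
      · rw [h'] at h
        omega
    · rintro ⟨h1, h2⟩
      have h3 := hE.2 h1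
      have h4 : (σ j : ℕ) ≠ σ i := fun h => h2 (Fin.ext h)
      omega
  have hind := ncard_inNbrs_le (connect G (σ i) L)
  have hidx := index_le_wordBound d hjn hin
  have hidx' := index_le_wordBound d hin hjn
  have hsj := sum (σ j)
  have hdeg := Finset.le_sup (f := d) (Finset.mem_univ (σ j))
  have hdeg' := Finset.le_sup (f := d) (Finset.mem_univ (σ i))
  have hindj := hind (σ j)
  refine ⟨by omega, by omega, by omega, by omega, by omega, by omega, by omega, by omega, by omega,
    fun hx => ⟨by omega, by omega, by omega, by omega, by omega, by omega, by omega, ?_,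
      by omega⟩, fun hx => ⟨by omega, ?_, by omega⟩⟩
  · have hmem := htest.1 hx
    have hjL : σ j ∉ L := fun h => notMem_leading σ j h.1
    have hnew : allowedBefore G σ (σ i) (s.reg 2 + 1) = insert (σ j) L :=
      allowedBefore_succ_of_mem (j := j) hmem
    have hij : ¬ (connect G (σ i) L).Adj (σ i) (σ j) := by
      rintro (h | h)
      · exact notMem_leading σ i (hsrc _ _ h)
      · exact hjL h.2
    constructor
    all_goals simp only [RamState.reg_setReg, RamState.arr_setReg, RamState.reg_setArr,
      RamState.arr_setArr, Nat.reduceEqDiff, reduceIte]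
    any_goals assumption
    · omega
    · rw [hnew, Set.ncard_insert_of_notMem hjL, count]
    · exact fun _ => trivial
    · rw [hnew, connect_insert]
      exact adj.connect_singleton _ _
    · intro w
      rw [hnew, connect_insert, Function.update_apply]
      by_cases hw' : w = σ j
      · rw [if_pos (congrArg _ hw'), hw', ncard_inNbrs_connect_self (Set.mem_singleton _) hij, hsj]
        rfl
      · rw [if_neg fun h => hw' (Fin.ext h), inNbrs_connect_of_notMem (by simpa using hw'), sum]
  · have hmem := mt htest.2 hx
    have hnew : allowedBefore G σ (σ i) (s.reg 2 + 1) = L :=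
      allowedBefore_succ_of_notMem (j := j) hmem
    constructor
    all_goals simp only [RamState.reg_setReg, RamState.arr_setReg, RamState.reg_setArr,
      RamState.arr_setArr, Nat.reduceEqDiff, reduceIte, hnew]
    any_goals assumption
    · omega
    · exact fun _ => trivial

theorem runs_select {n : ℕ} (d : OVS n) {i : Fin n} {σ : Equiv.Perm (Fin n)}
    {G : Digraph (Fin n)} {s : RamState} (hs : MainInv d i σ G s) :
    Runs (wordBound d) selectVertex s selectVertex.cost (ConnectInv d i σ G) := by
  obtain ⟨len, one, idx, idx_le, ok, input, adj, perm, sum, source, sorted, cont⟩ := hs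
  have hb := add_le_wordBound d
  have hidx := index_le_wordBound d (σ i).2 (σ i).2
  have hin := (σ i).2
  have hdeg := Finset.le_sup (f := d) (Finset.mem_univ (σ i))
  have hempty : allowedBefore G σ (σ i) 0 = ∅ := by
    ext v
    simp [allowedBefore, leading]
  refine Runs.of_wp ?_
  simp only [selectVertex, wp, RamState.reg_setReg, RamState.arr_setReg, RamOp.eval,
    Nat.reduceEqDiff, reduceIte, idx, perm, input, inputArr_coe, len]
  refine ⟨by omega, by omega, by omega, by omega, by omega, by omega, ?_⟩
  constructor
  all_goals simp only [RamState.reg_setReg, RamState.arr_setReg, Nat.reduceEqDiff, reduceIte,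
    hempty, connect_empty, Set.ncard_empty]
  any_goals assumption
  any_goals omega
  exact fun _ => trivial

theorem runs_connect {n : ℕ} (d : OVS n) {i : Fin n} {σ : Equiv.Perm (Fin n)}
    {G : Digraph (Fin n)} (hsrc : ∀ u w, G.Adj u w → u ∈ leading σ i) {s : RamState}
    (hs : ConnectInv d i σ G s) :
    Runs (wordBound d) (.loop 2 1 connectBody) s ((connectBody.cost + 1) * n + 1) fun s' =>
      ConnectInv d i σ G s' ∧ s'.reg 2 = n :=
  (Runs.loop n (ConnectInv d i σ G) (fun _ h => h.len) (fun _ h hlt => runs_connectBody d hsrc h hlt)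
    hs).mono le_rfl fun _ h => ⟨h.1, le_antisymm h.1.pos_le h.2⟩

/-! ### Verification of the main loop -/

theorem lexLe_iff {n : ℕ} {d : OVS n} {G : Digraph (Fin n)} {u v : Fin n} :
    (d u + (inNbrs G u).ncard) * (d u + (inNbrs G u).ncard) + d u ≤
      (d v + (inNbrs G v).ncard) * (d v + (inNbrs G v).ncard) + d v ↔ LexLe d G u v :=
  sq_add_le_sq_add_iff (Nat.le_add_right _ _) (Nat.le_add_right _ _)

theorem isGNormal_leading {n : ℕ} {d : OVS n} {i : ℕ} {σ : Equiv.Perm (Fin n)}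
    {G : Digraph (Fin n)} (hi : i ≤ n)
    (h : ∀ a b : Fin n, i ≤ a → a < b → LexLe d G (σ a) (σ b)) :
    IsGNormal d (leading σ i) G σ := by
  have hc : (leading σ i).ncard = i := ncard_setOf_exists_lt σ hi
  refine ⟨fun j hj => ⟨j, hc ▸ hj, rfl⟩, fun a b ha hab => h a b (hc ▸ ha) ?_⟩
  rw [Fin.lt_def]
  omega

/-- The state after the answer "No". -/
structure Refused {n : ℕ} (d : OVS n) (s : RamState) : Prop where
  len : s.reg 1 = n
  idx : s.reg 4 = n
  ok : s.reg 15 = 0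
  run : GreedyRun d none

/-- If the count stays short of the degree, the split has moved with the scan to the end, so the
count is the number of all allowed vertices. -/
theorem ConnectInv.greedyRun_none {n : ℕ} {d : OVS n} {i : Fin n} {σ : Equiv.Perm (Fin n)}
    {G : Digraph (Fin n)} {s s' : RamState} (hs : MainInv d i σ G s) (h : ConnectInv d i σ G s')
    (hend : s'.reg 2 = n) (hlt : s'.reg 12 < d (σ i)) : GreedyRun d none := by
  refine hs.cont _ (.refuse i _ G σ (isGNormal_leading hs.idx_le hs.sorted) ?_)
  have hall : allowedBefore G σ (σ i) n = allowed G (σ i) := by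
    ext w
    simp [allowedBefore, mem_leading]
  have := h.count
  rw [h.split_eq hlt, hend, hall] at this
  omega

theorem ConnectInv.isLeftmost {n : ℕ} {d : OVS n} {i : Fin n} {σ : Equiv.Perm (Fin n)}
    {G : Digraph (Fin n)} {s : RamState} (h : ConnectInv d i σ G s)
    (hle : ¬ s.reg 12 < d (σ i)) :
    IsLeftmost σ (allowed G (σ i)) (d (σ i)) (allowedBefore G σ (σ i) (s.reg 13)) := by
  refine ⟨Set.inter_subset_right, ?_, fun u hu w hw hwL => ?_⟩
  · have := h.count
    have := h.count_le
    omega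
  · have h1 := mem_leading.1 hu.1
    have h2 : w ∉ leading σ (s.reg 13) := fun h' => hwL ⟨h', hw⟩
    rw [mem_leading] at h2
    rw [Fin.lt_def]
    omega

theorem ConnectInv.isArrangement {n : ℕ} {d : OVS n} {i : Fin n} {σ : Equiv.Perm (Fin n)}
    {G : Digraph (Fin n)} {s : RamState} (h : ConnectInv d i σ G s) (hend : s.reg 2 = n) :
    IsArrangement n (s.arr 4) := by
  have hQ : ∀ l (hl : l < n), s.arr 4 l = σ ⟨l, hl⟩ := fun l hl => h.copy ⟨l, hl⟩ (by omega)
  refine ⟨fun l hl => by rw [hQ l hl]; exact (σ _).2, fun l hl l' hl' he => ?_⟩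
  rw [hQ l hl, hQ l' hl'] at he
  exact Fin.mk.inj (σ.injective (Fin.ext he))

/-- One round in linear time: a scan that connects the vertex, then either an exit or a merge that
restores the order of the unprocessed vertices. -/
theorem runs_mainBody {n : ℕ} (d : OVS n) {i : Fin n} {σ : Equiv.Perm (Fin n)}
    {G : Digraph (Fin n)} {s : RamState} (hs : MainInv d i σ G s) :
    Runs (wordBound d) mainBody s
      (selectVertex.cost + ((connectBody.cost + 1) * n + 1 +
        (2 + (mergeSetup.cost + ((mergeBody.cost + 1) * n + 1 + 1)) + 1))) fun s' =>
      (∃ σ' G', MainInv d (i + 1) σ' G' s') ∨ Refused d s' := by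
  have hb := add_le_wordBound d
  refine (runs_select d hs).seq fun s₁ hs₁ => (runs_connect d hs.source hs₁).seq ?_
  rintro s₂ ⟨hs₂, hend⟩
  refine Runs.ite (fun hlt => ?_) fun hle => ?_
  · rw [hs₂.degree] at hlt
    have hrun := hs₂.greedyRun_none hs hend hlt
    refine Runs.mono (Runs.of_wp (Q := Refused d) ?_) (Nat.le_add_right _ _) fun _ => Or.inr
    simp only [wp, RamState.reg_setReg, Nat.reduceEqDiff, reduceIte, hs₂.len]
    refine ⟨by omega, by omega, ?_⟩
    constructor <;> simp [RamState.reg_setReg, hs₂.len, hrun]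
  rw [hs₂.degree] at hle
  have hleft := hs₂.isLeftmost hle
  have hQ := hs₂.isArrangement hend
  have hsplit := hs₂.split_le
  have hin := i.2
  have hcopy : ∀ l : Fin n, s₂.arr 4 l = σ l := fun l => hs₂.copy l (by omega)
  -- This is the maximum of the split and `i + 1`. If the processed vertices and `v` already fill
  -- the scanned part, the first run is empty.
  obtain ⟨S, hS⟩ : ∃ S, S = s₂.reg 13 - (i + 1) + (i + 1) := ⟨_, rfl⟩
  refine Runs.mono (Runs.seq (R := fun s' =>
    MergeState d i S (s₂.arr 1) (s₂.arr 3) (s₂.arr 4) s' ∧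
    MergeInv (mergeKey d (s₂.arr 3)) (s₂.arr 4) n (i + 1) S (s'.arr 2) (s'.reg 16) (s'.reg 17)
      (s'.reg 18)) (Runs.of_wp ?_) ?_) (Nat.le_add_left _ _) fun _ => Or.inl
  · simp only [mergeSetup, wp, RamState.reg_setReg, RamState.arr_setReg, RamOp.eval,
      Nat.reduceEqDiff, reduceIte, hs₂.idx, hs₂.one, ← hS]
    refine ⟨by omega, by omega, by omega, by omega, by omega, ?_, ?_⟩
    · have h1 := hs₂.len
      have h2 := hs₂.one
      have h3 := hs₂.idx
      have h4 := hs₂.ok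
      have h5 := hs₂.input
      constructor <;> simp only [RamState.reg_setReg, RamState.arr_setReg, Nat.reduceEqDiff,
        reduceIte, h1, h2, h3, h4, h5]
    · refine ⟨le_rfl, by omega, le_rfl, by omega, rfl, fun l hl => ?_, ?_, ?_, ?_, ?_⟩
      · exact (hs₂.perm ⟨l, by omega⟩).trans (hcopy ⟨l, by omega⟩).symm
      all_goals intros; omega
  set L := allowedBefore G σ (σ i) (s₂.reg 13) with hL
  set G' := connect G (σ i) L with hG'
  have hkey : ∀ v : Fin n, mergeKey d (s₂.arr 3) v =
      (d v + (inNbrs G' v).ncard) * (d v + (inNbrs G' v).ncard) + d v := fun v => by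
    rw [mergeKey, hs₂.sum, inputArr_coe]
  -- Adding the same amount `c` to both indegrees preserves the old lexicographic order.
  have hrun : ∀ (c : ℕ) (g g' : ℕ), i < g → g ≤ g' → g' < n →
      (∀ g'' : Fin n, (g'' : ℕ) = g ∨ (g'' : ℕ) = g' →
        (inNbrs G' (σ g'')).ncard = (inNbrs G (σ g'')).ncard + c) →
      mergeKey d (s₂.arr 3) (s₂.arr 4 g) ≤ mergeKey d (s₂.arr 3) (s₂.arr 4 g') := by
    intro c g g' hig hgg hg hc
    rcases hgg.lt_or_eq with hlt | rfl
    swap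
    · exact le_rfl
    have h1 := hs.sorted ⟨g, by omega⟩ ⟨g', hg⟩ hig.le hlt
    rw [hcopy ⟨g, by omega⟩, hcopy ⟨g', hg⟩, hkey, hkey, lexLe_iff]
    unfold LexLe at h1 ⊢
    rw [hc ⟨g, by omega⟩ (Or.inl rfl), hc ⟨g', hg⟩ (Or.inr rfl)]
    omega
  have hsrc : ¬ ∃ w, G.Adj (σ i) w := fun ⟨w, hw⟩ => notMem_leading σ i (hs.source _ _ hw)
  rintro s₃ ⟨hs₃, hm⟩
  refine (runs_merge d hQ (fun w hw => ?_) (fun g g' h1 h2 h3 => ?_) (fun g g' h1 h2 h3 => ?_) hs₃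
    hm).seq ?_
  · have h1 : s₂.arr 3 w = d ⟨w, hw⟩ + (inNbrs G' ⟨w, hw⟩).ncard := hs₂.sum ⟨w, hw⟩
    have h2 := ncard_inNbrs_le G' ⟨w, hw⟩
    have h3 := Finset.le_sup (f := d) (Finset.mem_univ ⟨w, hw⟩)
    omega
  -- Between `i` and the split every vertex is allowed, because in-neighbours of `v` are processed
  -- and hence lie before `i`; so each gains exactly one.
  · refine hrun 1 g g' h1 h2 (by omega) fun g'' hg => ?_
    refine ncard_inNbrs_connect_self ⟨mem_leading.2 ?_, fun h => ?_, fun h => ?_⟩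
      fun h => hsrc ⟨_, h⟩
    · rw [Equiv.symm_apply_apply]
      omega
    · have := mem_leading.1 (hs.source _ _ h)
      rw [Equiv.symm_apply_apply] at this
      omega
    · have := σ.injective h
      subst this
      omega
  · refine hrun 0 g g' (by omega) h2 h3 fun g'' hg => ?_
    rw [inNbrs_connect_of_notMem fun h => ?_, Nat.add_zero]
    have := mem_leading.1 h.1
    rw [Equiv.symm_apply_apply] at this
    omega
  rintro s₄ ⟨hs₄, a, b, hm₄⟩
  obtain ⟨σ', hσ'⟩ := (hm₄.isArrangement hQ).exists_perm
  have hsame : ∀ j : Fin n, (j : ℕ) < i + 1 → σ' j = σ j := fun j hj => by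
    refine Fin.ext ?_
    rw [← hσ', hm₄.before j hj, hcopy]
  have hlead : leading σ' (i + 1) = insert (σ i) (leading σ i) := by
    rw [← leading_succ]
    ext v
    constructor
    · rintro ⟨j, hj, rfl⟩
      exact ⟨j, hj, (hsame j hj).symm⟩
    · rintro ⟨j, hj, rfl⟩
      exact ⟨j, hj, hsame j hj⟩
  refine Runs.of_wp ?_
  simp only [wp, RamOp.eval, hs₄.idx, hs₄.one]
  refine ⟨by omega, σ', G', ?_⟩
  constructor <;> try simp only [RamState.reg_setReg, RamState.arr_setReg, Nat.reduceEqDiff,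
    reduceIte, hs₄.len, hs₄.one, hs₄.ok, hs₄.input, hs₄.adj, hs₄.sum]
  · omega
  · exact hs₂.adj
  · exact hσ'
  · exact hs₂.sum
  · rw [hlead]
    rintro u w (h | ⟨rfl, -⟩)
    · exact Or.inr (hs.source _ _ h)
    · exact Or.inl rfl
  · intro a b ha hab
    rw [← lexLe_iff, ← hkey, ← hkey, ← hσ', ← hσ']
    exact hm₄.sorted a b ha hab b.2
  -- The abstract round is prepended here: an outcome from the new state is an outcome from the old
  -- one by `extend`, and the old continuation carries it back to the start.
  · intro r hr
    rw [hlead] at hr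
    refine hs.cont r (.extend i _ G σ L r (isGNormal_leading hs.idx_le hs.sorted) ?_ hleft hr)
    rw [← hleft.2.1]
    exact Set.ncard_le_ncard hleft.1 (Set.toFinite _)

theorem runs_main {n : ℕ} (d : OVS n) {s : RamState} {i : ℕ} {σ : Equiv.Perm (Fin n)}
    {G : Digraph (Fin n)} (hs : MainInv d i σ G s) :
    Runs (wordBound d) (.loop 4 1 mainBody) s
      ((selectVertex.cost + ((connectBody.cost + 1) * n + 1 +
        (2 + (mergeSetup.cost + ((mergeBody.cost + 1) * n + 1 + 1)) + 1)) + 1) * n + 1) fun s' =>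
      (∃ σ' G', MainInv d n σ' G' s') ∨ Refused d s' := by
  refine (Runs.loop n (fun s => (∃ i σ G, MainInv d i σ G s) ∨ Refused d s) ?_ ?_
    (Or.inl ⟨i, σ, G, hs⟩)).mono le_rfl ?_
  · rintro s (⟨i, σ, G, h⟩ | h)
    · exact h.len
    · exact h.len
  · rintro s (⟨i, σ, G, h⟩ | h) hlt
    · have hi := h.idx
      obtain ⟨i, rfl⟩ : ∃ j : Fin n, (j : ℕ) = i := ⟨⟨i, by omega⟩, rfl⟩
      refine (runs_mainBody d h).mono le_rfl ?_
      rintro s' (⟨σ', G', h'⟩ | h')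
      · exact ⟨Or.inl ⟨_, σ', G', h'⟩, by rw [hi, h'.idx]; omega⟩
      -- A refusal sets the loop index to `n`, which counts as progress and ends the loop.
      · exact ⟨Or.inr h', by rw [h'.idx]; exact hlt⟩
    · exact absurd h.idx hlt.ne
  · rintro s ⟨⟨i, σ, G, h⟩ | h, hle⟩
    · have h1 := h.idx
      have h2 := h.idx_le
      have : i = n := by omega
      subst this
      exact Or.inl ⟨σ, G, h⟩
    · exact Or.inr h

/-- The invariant of the main loop holds after the initial phases. -/
theorem mainInv_of_initState {n : ℕ} (d : OVS n) {s : RamState} (hs : InitState d s)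
    (hsum : SumInit d s) (harr : IsArrangement n (s.arr 2))
    (hsort : ∀ a b, a ≤ b → b < n → inputArr d (s.arr 2 a) ≤ inputArr d (s.arr 2 b))
    (hle : s.reg 4 ≤ n) (hz : ∀ l < s.reg 4, inputArr d (s.arr 2 l) = 0)
    (hnz : ∀ l < n, s.reg 4 = l → inputArr d (s.arr 2 l) ≠ 0) (hok : s.reg 15 = 1) :
    ∃ σ, MainInv d (s.reg 4) σ ⊥ s := by
  obtain ⟨σ, hσ⟩ := harr.exists_perm
  have hin : ∀ w : Fin n, (inNbrs (⊥ : Digraph (Fin n)) w).ncard = 0 := fun w => by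
    rw [Set.ncard_eq_zero (Set.toFinite _)]
    ext
    simp [inNbrs]
  have hval : ∀ j : Fin n, inputArr d (s.arr 2 j) = d (σ j) := fun j => by
    rw [hσ, inputArr_coe]
  have hle' : ∀ a b : Fin n, a ≤ b → d (σ a) ≤ d (σ b) := fun a b hab => by
    rw [← hval, ← hval]
    exact hsort a b hab b.2
  refine ⟨σ, hs.len, hs.one, rfl, hle, hok, hs.input, ?_, hσ, ?_, ?_, ?_, ?_⟩
  · intro u v
    rw [hs.adj]
    simp
  · intro w
    rw [hin, hsum w w.2, inputArr_coe]
    rfl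
  · intro u w h
    simp at h
  · intro a b ha hab
    unfold LexLe
    rw [hin, hin]
    have := hle' a b hab.le
    omega
  · intro r hr
    refine ⟨σ, s.reg 4, fun a b hab => hle' a b ?_, hle, fun j hj => ?_, fun j hj => ?_, hr⟩
    · rw [Fin.le_def]
      omega
    · rw [← hval]
      exact hz j hj
    · rw [← hval]
      exact hnz j j.2 hj.symm

theorem runs_greedy (n : ℕ) (d : OVS n) :
    Runs (wordBound d) greedy (ramInput d) (100 * (n + 1) ^ 2) fun s =>
      ∃ r, GreedyRun d r ∧ RamOutput s r := by
  have hb := add_le_wordBound d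
  refine Runs.mono ?_ (T := setup.cost + (((initBody.cost + 1) * n + 1) + (1 +
    (((1 + ((insertBody.cost + 1) * n + 1 + 1) + 1) * n + 1) + (2 +
    (((zeroBody.cost + 1) * n + 1) + (1 +
    (((selectVertex.cost + ((connectBody.cost + 1) * n + 1 + (2 + (mergeSetup.cost +
      ((mergeBody.cost + 1) * n + 1 + 1)) + 1)) + 1) * n + 1) + 1)))))))) ?_ fun _ => id
  swap
  -- The costs of the three inner loop bodies, each plus one, are 9, 21 and 21, so the quadratic
  -- coefficient is 51; the factor `100` leaves room for the lower terms.
  · simp only [setup, initBody, insertBody, zeroBody, selectVertex, connectBody, mergeSetup,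
      mergeBody, mergeChoose, cost]
    norm_num
    nlinarith [Nat.zero_le (n ^ 2)]
  refine (runs_setup d).seq fun s₁ ⟨h₁, h₁'⟩ => (runs_init d h₁ h₁').seq ?_
  rintro s₂ ⟨⟨len, one, input, adj⟩, hsum, hid⟩
  refine Runs.seq (R := fun s => InitState d s ∧ SumInit d s ∧ IsArrangement n (s.arr 2) ∧
    s.reg 4 = 0) (Runs.of_wp ⟨by omega, ⟨?_, ?_, ?_, ?_⟩, hsum, ?_, ?_⟩) ?_
  any_goals simp only [RamState.reg_setReg, RamState.arr_setReg, Nat.reduceEqDiff, reduceIte]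
  any_goals assumption
  · exact ⟨fun l hl => by rwa [hid l hl], fun l hl l' hl' h => by rwa [hid l hl, hid l' hl'] at h⟩
  rintro s₃ ⟨h₃, hsum₃, harr₃, hi₃⟩
  refine (runs_sort d h₃ hsum₃ harr₃ hi₃).seq ?_
  rintro s₄ ⟨⟨len, one, input, adj⟩, hsum₄, harr₄, hsort₄⟩
  refine Runs.seq (R := fun s => InitState d s ∧ SumInit d s ∧ s.arr 2 = s₄.arr 2 ∧
    s.reg 2 = 0 ∧ s.reg 4 = 0)
    (Runs.of_wp ⟨by omega, by omega, ⟨?_, ?_, ?_, ?_⟩, hsum₄, rfl, ?_, ?_⟩) ?_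
  any_goals simp only [RamState.reg_setReg, RamState.arr_setReg, Nat.reduceEqDiff, reduceIte]
  any_goals assumption
  rintro s₅ ⟨h₅, hsum₅, harr₅, hj₅, hi₅⟩
  rw [← harr₅] at harr₄ hsort₄
  refine (runs_zero d h₅ hsum₅ harr₄ hsort₄ hj₅ hi₅).seq ?_
  rintro s₆ ⟨⟨len, one, input, adj⟩, hsum₆, harr₆, hsort₆, hle₆, hz₆, hnz₆⟩
  refine Runs.seq (R := fun s => ∃ i σ, MainInv d i σ ⊥ s)
    (Runs.of_wp ⟨by omega, _, mainInv_of_initState d ⟨?_, ?_, ?_, ?_⟩ hsum₆ harr₆ hsort₆ hle₆ hz₆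
      hnz₆ ?_⟩) ?_
  any_goals simp only [RamState.reg_setReg, RamState.arr_setReg, Nat.reduceEqDiff, reduceIte]
  any_goals assumption
  rintro s₇ ⟨i, σ, h₇⟩
  refine (runs_main d h₇).seq ?_
  rintro s₈ (⟨σ', G, h₈⟩ | h₈)
  · have hok := h₈.ok
    refine Runs.of_wp ⟨by omega, some G, h₈.cont _ (.finish _ _ _ le_rfl), ?_, h₈.adj⟩
    simp [RamState.reg_setReg, hok]
  · have hok := h₈.ok
    refine Runs.of_wp ⟨by omega, none, h₈.run, ?_⟩
    simp [RamOutput, RamState.reg_setReg, hok]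

/-- For `n ≥ 3` the logarithm is at least `1` because `e < 3`, and `(n + 1)² ≤ 4n²`, whence the
constant `400`. -/
theorem sq_isBigO_sq_mul_log :
    (fun n : ℕ => ((100 * (n + 1) ^ 2 : ℕ) : ℝ)) =O[atTop]
      (fun n : ℕ => (n : ℝ) ^ 2 * Real.log n) := by
  refine IsBigO.of_bound 400 ?_
  filter_upwards [eventually_ge_atTop 3] with n hn
  have h3 : (3 : ℝ) ≤ n := by exact_mod_cast hn
  have hlog : 1 ≤ Real.log n := by
    rw [Real.le_log_iff_exp_le (by linarith)]
    exact Real.exp_one_lt_three.le.trans h3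
  rw [Real.norm_of_nonneg (by positivity), Real.norm_of_nonneg (by positivity)]
  push_cast
  have : (n : ℝ) ^ 2 * 1 ≤ (n : ℝ) ^ 2 * Real.log n := by gcongr
  nlinarith

theorem theorem2 :
    -- every run of the greedy algorithm decides realizability, and returns a realization if any
    (∀ (n : ℕ) (d : OVS n) (r : Option (Digraph (Fin n))), GreedyRun d r →
      (r = none ↔ ¬ IsOVGS d) ∧ ∀ G, r = some G → Realizes d G) ∧
    -- one machine program carries out the algorithm in time `O(n² log n)`, on words of
    -- `O(log (n + max d))` bits
    ∃ (p : RamProg) (c : ℕ) (T : ℕ → ℕ),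
      (fun n : ℕ => (T n : ℝ)) =O[atTop] (fun n : ℕ => (n : ℝ) ^ 2 * Real.log n) ∧
      ∀ (n : ℕ) (d : OVS n), ∃ (t : ℕ) (s : RamState) (r : Option (Digraph (Fin n))),
        RamExec ((n + Finset.univ.sup d + 2) ^ c) p (ramInput d) t s ∧ t ≤ T n ∧
        GreedyRun d r ∧ RamOutput s r := by
  refine ⟨fun n d r hr => hr.correct, greedy, 2, fun n => 100 * (n + 1) ^ 2,
    sq_isBigO_sq_mul_log, fun n d => ?_⟩
  obtain ⟨t, s, h1, h2, r, h3, h4⟩ := runs_greedy n d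
  exact ⟨t, s, r, h1, h2, h3, h4⟩
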